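/- All graphs are finite and simple, and $v_G$, $e_G$ denote the numbers of vertices and edges of $G$. Put $d_2(G)=(e_G-1)/(v_G-2)$ if $v_G\ge 3$ and $d_2(G)=0$ otherwise, and $m_2(G)=\max\{d_2(K):K\subseteq G\}$. Call $G$ strictly $2$-balanced if $v_G\ge 3$ and $d_2(K)<d_2(G)$ for every proper subgraph $K\subsetneq G$. For a graph $H$ let $$\varrho(H)=\sum_{(a,b)}\frac{1}{\mathrm{aut}(H;a,b)},$$ where $(a,b)$ ranges over a set of representatives of the orbits of $\mathrm{Aut}(H)$ on ordered edges of $H$ and $\mathrm{aut}(H;a,b)$ is the number of automorphisms of $H$ fixing both $a$ and $b$, and let $$p^*_H(n)=n^{-1/m_2(H)}\Bigl[\bigl(2-1/m_2(H)\bigr)\varrho(H)^{-1}\ln n\Bigr]^{1/(e_H-1)} .$$ Let $\mathcal Q_H$ be the set of graphs $G$ such that every edge of $G$ lies in a copy of $H$, that is, in a (not necessarily induced) subgraph of $G$ isomorphic to $H$. Let $G_{n,p}$ be the binomial random graph on $n$ labelled vertices with edge probability $p$. **Lemma.** Let $H$ be a fixed connected, strictly $2$-balanced graph and let $\varepsilon>0$.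 For every sequence $p=p(n)\in[0,1]$: 1. if $n^{-2}=o(p(n))$ and $p(n)<(1-\varepsilon)p^*_H(n)$ for all large $n$, then $\mathbb P(G_{n,p(n)}\in\mathcal Q_H)\to 0$ as $n\to\infty$; 2. if $p(n)>(1+\varepsilon)p^*_H(n)$ for all large $n$, then $\mathbb P(G_{n,p(n)}\in\mathcal Q_H)\to 1$ as $n\to\infty$. -/

import Mathlib

open Filter Topology Asymptotics

namespace SharpThreshold

noncomputable section

open SimpleGraph

/-- The `2`-density `d₂(G) = (e_G - 1) / (v_G - 2)` if `v_G ≥ 3`, and `0` otherwise. -/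
def twoDensity {V : Type*} (G : SimpleGraph V) : ℝ :=
  if 3 ≤ Nat.card V then ((G.edgeSet.ncard : ℝ) - 1) / ((Nat.card V : ℝ) - 2) else 0

/-- The maximum `2`-density `m₂(G) = max {d₂(K) : K ⊆ G}`
(a maximum over finitely many subgraphs when `G` is finite). -/
def maxTwoDensity {V : Type*} (G : SimpleGraph V) : ℝ :=
  ⨆ K : G.Subgraph, twoDensity K.coe

/-- `G` is strictly `2`-balanced: `v_G ≥ 3`, and `d₂(K) < d₂(G)` for every proper subgraph `K`. -/
def IsStrictlyTwoBalanced {V : Type*} (G : SimpleGraph V) : Prop :=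
  3 ≤ Nat.card V ∧ ∀ K : G.Subgraph, K ≠ ⊤ → twoDensity K.coe < twoDensity G

/-- Two ordered edges `(a, b)`, `(a', b')` of `G` have the same isomorphism type if some
automorphism of `G` takes `a` to `a'` and `b` to `b'`. -/
def orderedEdgeSetoid {V : Type*} (G : SimpleGraph V) : Setoid G.Dart where
  r d d' := ∃ φ : G ≃g G, φ d.fst = d'.fst ∧ φ d.snd = d'.snd
  iseqv :=
    { refl := fun _ => ⟨RelIso.refl _, rfl, rfl⟩
      symm := by
        rintro d d' ⟨φ, h₁, h₂⟩
        exact ⟨φ.symm, by rw [← h₁]; exact φ.symm_apply_apply _,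
          by rw [← h₂]; exact φ.symm_apply_apply _⟩
      trans := by
        rintro d d' d'' ⟨φ, h₁, h₂⟩ ⟨ψ, h₃, h₄⟩
        exact ⟨φ.trans ψ, by rw [← h₃, ← h₁]; rfl, by rw [← h₄, ← h₂]; rfl⟩ }

/-- `aut(G; a, b)`: the number of automorphisms of `G` that fix both `a` and `b`. -/
def autFixing {V : Type*} (G : SimpleGraph V) (a b : V) : ℕ :=
  Nat.card {φ : G ≃g G // φ a = a ∧ φ b = b}

/-- `ρ(G) = ∑ 1 / aut(G; a, b)`, over representatives `(a, b)` of the isomorphism types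
of ordered edges of `G` (a finite sum when `G` is finite). -/
def rho {V : Type*} (G : SimpleGraph V) : ℝ :=
  ∑ᶠ q : Quotient (orderedEdgeSetoid G), 1 / (autFixing G q.out.fst q.out.snd : ℝ)

/-- `p*_H(n) = n^{-1/m₂(H)} * ((2 - 1/m₂(H)) * ρ(H)⁻¹ * ln n)^{1/(e_H - 1)}`. -/
def pStar {V : Type*} (H : SimpleGraph V) (n : ℕ) : ℝ :=
  (n : ℝ) ^ (-(1 / maxTwoDensity H)) *
    ((2 - 1 / maxTwoDensity H) * (rho H)⁻¹ * Real.log n) ^ (1 / ((H.edgeSet.ncard : ℝ) - 1))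

/-- `𝒬_H`: the graphs on `V` in which every edge lies in a copy of `H`, a copy being a
(not necessarily induced) subgraph isomorphic to `H`. -/
def edgesInCopies {W : Type*} (H : SimpleGraph W) (V : Type*) : Set (SimpleGraph V) :=
  {G | ∀ e ∈ G.edgeSet, ∃ K : G.Subgraph, Nonempty (H ≃g K.coe) ∧ e ∈ K.edgeSet}

end

end SharpThreshold

/-!
Fix a pair `e` of vertices. The number of copies of `H` in the complete graph that contain `e` is
asymptotically `ρ(H) n ^ (v_H - 2)`, because `ρ(H) = 2 e_H / |Aut H|` by the orbit-stabilizer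
theorem (`rho_eq`, `card_copiesThrough_le`, `le_card_copiesThrough`). If `e` is an edge, each of
these copies is present with probability `p ^ (e_H - 1)`, so that at `p = p*_H(n)` their expected
number is about `(2 - 1 / m₂(H)) ln n` (`rho_mul_pow_mul_pStar_pow`). Were the copies independent,
`e` would lie in none of them with probability about `n ^ -(2 - 1 / m₂(H))`, the inverse, up to
logarithmic factors, of the expected number of edges `n ^ 2 p / 2`. The threshold is where the
expected number of edges in no copy passes from large to small.

The deviation from independence is controlled from both sides. Harris' inequality gives the lower
bound `prod_le_prob_avoid`, and Janson's inequality `prob_avoid_le` the upper bound, up to a factor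
`exp Δ` with `Δ` a sum over pairs of overlapping copies. A second copy overlaps a given one in a
subgraph with edge set `A` and at least two edges, and the expected number of ways to complete it is
at most a constant times `n ^ (v_H - v_A) p ^ (e_H - e_A)`. For a proper subgraph this tends to zero
polynomially fast at the threshold, precisely because `H` is strictly `2`-balanced
(`density_lt`, `tendsto_errorTerm`).

Above the threshold, the union bound over all edges finishes the proof. Since `p` may be much larger
than `p*_H(n)`, the probability that `e` lies in no copy is compared with the one at a constant
multiple of `p*_H(n)` through its monotonicity in `p` (`prob_anti`).

Below the threshold, the second moment method (`prob_forall_notMem_le`) is applied to the number of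
edges in no copy. For two pairs `e` and `f`, Janson's inequality is used for the copies containing
exactly one of them. In a new kind of overlap, two such copies agree except for the edges `e` and
`f`; then the first copy also has a vertex of `f` outside `e`, and there are too few such copies to
matter (`mem_copiesNear_of_subset`, `card_copiesNear_le`). The exception is the path with three
vertices when `e` and `f` are adjacent, where `e` and `f` themselves form a copy of `H` and cannot
both be edges in no copy.
-/

namespace SharpThreshold

open Finset

/-! ### Random subsets of a finite set -/

section Events

variable {α : Type*}

/-- The event that the random set contains none of the sets `A i`, `i ∈ s`. -/
def avoid {ι : Type*} (s : Finset ι) (A : ι → Finset α) : Set (Finset α) :=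
  {S | ∀ i ∈ s, ¬ A i ⊆ S}

lemma isLowerSet_avoid {ι : Type*} (s : Finset ι) (A : ι → Finset α) : IsLowerSet (avoid s A) :=
  fun _ _ hST h i hi hS ↦ h i hi (hS.trans hST)

lemma isUpperSet_subset (E : Finset α) : IsUpperSet {S : Finset α | E ⊆ S} :=
  fun _ _ hST h ↦ Subset.trans h hST

lemma monotone_indicator {A : Set (Finset α)} (hA : IsUpperSet A) :
    Monotone (A.indicator (1 : Finset α → ℝ)) := by
  intro S T hST
  by_cases h : S ∈ A
  · simp [h, hA hST h]
  · rw [Set.indicator_of_notMem h]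
    exact Set.indicator_nonneg (fun _ _ ↦ zero_le_one) _

variable [DecidableEq α]

/-- The event `B` on subsets of `α` does not look at the elements of `E`: membership in `B` is
unchanged when elements of `E` are added or removed. -/
def Insensitive (B : Set (Finset α)) (E : Finset α) : Prop :=
  ∀ x ∈ E, ∀ S, x ∉ S → (insert x S ∈ B ↔ S ∈ B)

lemma insensitive_avoid {ι : Type*} {s : Finset ι} {A : ι → Finset α} {E : Finset α}
    (h : ∀ i ∈ s, Disjoint E (A i)) : Insensitive (avoid s A) E := by
  intro x hx S hS
  refine forall₂_congr fun i hi ↦ ?_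
  rw [subset_insert_iff_of_notMem (disjoint_left.1 (h i hi) hx)]

end Events

section RandomSubset

variable {α : Type*} [Fintype α] [DecidableEq α]

/-- The probability that the random subset of `α`, to which every element belongs independently
with probability `p`, equals `S`. -/
noncomputable def weight (p : ℝ) (S : Finset α) : ℝ := p ^ #S * (1 - p) ^ #Sᶜ

/-- The expectation of `f` on the `p`-random subset of `α`. -/
noncomputable def mean (p : ℝ) (f : Finset α → ℝ) : ℝ := ∑ S, weight p S * f S

/-- The probability that the `p`-random subset of `α` belongs to `A`. -/
noncomputable def prob (p : ℝ) (A : Set (Finset α)) : ℝ := mean p (A.indicator 1)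

variable {p : ℝ}

lemma weight_nonneg (h0 : 0 ≤ p) (h1 : p ≤ 1) (S : Finset α) : 0 ≤ weight p S :=
  mul_nonneg (pow_nonneg h0 _) (pow_nonneg (sub_nonneg.2 h1) _)

lemma sum_weight (p : ℝ) : ∑ S : Finset α, weight p S = 1 := by
  have := Fintype.sum_pow_mul_eq_add_pow α p (1 - p)
  simp only [add_sub_cancel, one_pow] at this
  rw [← this]
  exact sum_congr rfl fun S _ ↦ by rw [weight, card_compl]

lemma mean_add (f g : Finset α → ℝ) : mean p (fun S ↦ f S + g S) = mean p f + mean p g := by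
  simp [mean, mul_add, sum_add_distrib]

lemma mean_const_mul (c : ℝ) (f : Finset α → ℝ) : mean p (fun S ↦ c * f S) = c * mean p f := by
  simp [mean, mul_sum, mul_left_comm]

lemma mean_const (c : ℝ) : mean p (fun _ : Finset α ↦ c) = c := by
  simp [mean, ← sum_mul, sum_weight]

lemma mean_sum {ι : Type*} (s : Finset ι) (f : ι → Finset α → ℝ) :
    mean p (fun S ↦ ∑ i ∈ s, f i S) = ∑ i ∈ s, mean p (f i) := by
  simp only [mean, mul_sum]
  exact sum_comm

lemma mean_mono (h0 : 0 ≤ p) (h1 : p ≤ 1) {f g : Finset α → ℝ} (h : ∀ S, f S ≤ g S) :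
    mean p f ≤ mean p g :=
  sum_le_sum fun S _ ↦ mul_le_mul_of_nonneg_left (h S) (weight_nonneg h0 h1 S)

lemma prob_nonneg (h0 : 0 ≤ p) (h1 : p ≤ 1) (A : Set (Finset α)) : 0 ≤ prob p A :=
  sum_nonneg fun S _ ↦ mul_nonneg (weight_nonneg h0 h1 S)
    (Set.indicator_nonneg (fun _ _ ↦ zero_le_one) _)

lemma prob_mono (h0 : 0 ≤ p) (h1 : p ≤ 1) {A B : Set (Finset α)} (h : A ⊆ B) :
    prob p A ≤ prob p B :=
  mean_mono h0 h1 fun S ↦ Set.indicator_le_indicator_of_subset h (fun _ ↦ zero_le_one) S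

lemma prob_univ : prob p (Set.univ : Set (Finset α)) = 1 := by
  rw [prob, Set.indicator_univ]
  exact mean_const 1

lemma prob_empty : prob p (∅ : Set (Finset α)) = 0 := by
  simp [prob, mean]

lemma prob_add_prob_compl (A : Set (Finset α)) : prob p A + prob p Aᶜ = 1 := by
  rw [prob, prob, ← mean_add, ← mean_const (α := α) (p := p) 1]
  congr 1
  ext S
  exact congrFun (Set.indicator_self_add_compl A (1 : Finset α → ℝ)) S

lemma prob_inter_add_diff (A B : Set (Finset α)) :
    prob p (A ∩ B) + prob p (A \ B) = prob p A := by
  rw [prob, prob, ← mean_add, prob]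
  congr 1
  ext S
  by_cases hA : S ∈ A <;> by_cases hB : S ∈ B <;> simp [hA, hB]

lemma prob_biUnion_le (h0 : 0 ≤ p) (h1 : p ≤ 1) {ι : Type*} (s : Finset ι)
    (A : ι → Set (Finset α)) : prob p (⋃ i ∈ s, A i) ≤ ∑ i ∈ s, prob p (A i) := by
  simp only [prob]
  rw [← mean_sum]
  refine mean_mono h0 h1 fun S ↦ ?_
  by_cases h : S ∈ ⋃ i ∈ s, A i
  · rw [Set.indicator_of_mem h]
    simp only [Set.mem_iUnion] at h
    obtain ⟨i, hi, hS⟩ := h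
    refine le_trans ?_ (single_le_sum (f := fun i ↦ (A i).indicator (1 : Finset α → ℝ) S)
      (fun j _ ↦ Set.indicator_nonneg (fun _ _ ↦ zero_le_one) _) hi)
    simp [hS]
  · rw [Set.indicator_of_notMem h]
    exact sum_nonneg fun j _ ↦ Set.indicator_nonneg (fun _ _ ↦ zero_le_one) _

lemma weight_insert (p : ℝ) {x : α} {S : Finset α} (hx : x ∉ S) :
    (1 - p) * weight p (insert x S) = p * weight p S := by
  have hc : #Sᶜ = #(insert x S)ᶜ + 1 := by
    rw [compl_insert, card_erase_add_one (by simpa using hx)]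
  rw [weight, weight, card_insert_of_notMem hx, hc]
  ring

/-- The event `x ∈ S` is independent of every event that does not look at `x`. -/
lemma prob_mem_inter (p : ℝ) {x : α} {B : Set (Finset α)}
    (hB : ∀ S, x ∉ S → (insert x S ∈ B ↔ S ∈ B)) :
    prob p ({S | x ∈ S} ∩ B) = p * prob p B := by
  have key : (1 - p) * prob p (B ∩ {S | x ∈ S}) = p * prob p (B \ {S | x ∈ S}) := by
    simp only [prob, mean, mul_sum]
    have h1 : ∀ S : Finset α, (1 - p) * (weight p S * (B ∩ {S | x ∈ S}).indicator 1 S) =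
        if x ∈ S then (1 - p) * (weight p S * B.indicator 1 S) else 0 := by
      intro S
      by_cases hB : S ∈ B <;> by_cases hx : x ∈ S <;> simp [hB, hx]
    have h2 : ∀ S : Finset α, p * (weight p S * (B \ {S | x ∈ S}).indicator 1 S) =
        if x ∉ S then p * (weight p S * B.indicator 1 S) else 0 := by
      intro S
      by_cases hB : S ∈ B <;> by_cases hx : x ∈ S <;> simp [hB, hx]
    simp only [h1, h2, ← sum_filter]
    refine sum_bij' (fun S _ ↦ S.erase x) (fun S _ ↦ insert x S) ?_ ?_ ?_ ?_ ?_
    · simp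
    · simp
    · intro S hS
      exact insert_erase (by simpa using hS)
    · intro S hS
      exact erase_insert (by simpa using hS)
    · intro S hS
      have hx : x ∈ S := by simpa using hS
      have hw := weight_insert p (notMem_erase x S)
      have hm := hB _ (notMem_erase x S)
      rw [insert_erase hx] at hw hm
      rw [← mul_assoc, hw, ← mul_assoc]
      congr 1
      by_cases h : S ∈ B
      · simp [h, hm.1 h]
      · simp [h, mt hm.2 h]
  have hsum := prob_inter_add_diff (p := p) B {S | x ∈ S}
  rw [Set.inter_comm, ← hsum]
  linarith

lemma prob_notMem_inter (p : ℝ) {x : α} {B : Set (Finset α)}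
    (hB : ∀ S, x ∉ S → (insert x S ∈ B ↔ S ∈ B)) :
    prob p ({S | x ∉ S} ∩ B) = (1 - p) * prob p B := by
  have h := prob_inter_add_diff (p := p) B {S | x ∈ S}
  rw [Set.inter_comm, prob_mem_inter p hB] at h
  have h' : B \ {S | x ∈ S} = {S | x ∉ S} ∩ B := by ext; simp [and_comm]
  rw [h'] at h
  linarith

/-- The event `E ⊆ S` is independent of every event that does not look at `E`. -/
lemma prob_subset_inter (p : ℝ) (E : Finset α) {B : Set (Finset α)} (hB : Insensitive B E) :
    prob p ({S | E ⊆ S} ∩ B) = p ^ #E * prob p B := by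
  induction E using Finset.induction_on with
  | empty => simp
  | insert x E hx ih =>
    have : {S | insert x E ⊆ S} ∩ B = {S | x ∈ S} ∩ ({S | E ⊆ S} ∩ B) := by
      ext S; simp [insert_subset_iff, and_assoc]
    rw [this, prob_mem_inter, ih fun y hy ↦ hB y (mem_insert_of_mem hy), card_insert_of_notMem hx,
      pow_succ']
    · ring
    · intro S hS
      have : E ⊆ insert x S ↔ E ⊆ S := subset_insert_iff_of_notMem hx
      simp [this, hB x (mem_insert_self _ _) S hS]

lemma prob_disjoint_inter (p : ℝ) (E : Finset α) {B : Set (Finset α)} (hB : Insensitive B E) :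
    prob p ({S | Disjoint E S} ∩ B) = (1 - p) ^ #E * prob p B := by
  induction E using Finset.induction_on with
  | empty => simp
  | insert x E hx ih =>
    have : {S | Disjoint (insert x E) S} ∩ B = {S | x ∉ S} ∩ ({S | Disjoint E S} ∩ B) := by
      ext S; simp [and_assoc]
    rw [this, prob_notMem_inter, ih fun y hy ↦ hB y (mem_insert_of_mem hy),
      card_insert_of_notMem hx, pow_succ']
    · ring
    · intro S hS
      have : Disjoint E (insert x S) ↔ Disjoint E S := by simp [hx]
      simp [this, hB x (mem_insert_self _ _) S hS]

lemma prob_subset (p : ℝ) (E : Finset α) : prob p {S | E ⊆ S} = p ^ #E := by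
  have := prob_subset_inter p E (B := Set.univ) fun _ _ _ _ ↦ by simp
  simpa [prob_univ] using this

lemma mean_mul_le (h0 : 0 ≤ p) (h1 : p ≤ 1) {f g : Finset α → ℝ} (hf0 : 0 ≤ f) (hg0 : 0 ≤ g)
    (hf : Monotone f) (hg : Monotone g) :
    mean p f * mean p g ≤ mean p (fun S ↦ f S * g S) := by
  have := fkg f g (weight p : Finset α → ℝ) (weight_nonneg h0 h1) hf0 hg0 hf hg fun a b ↦ by
    have h2 : #(a ∩ b)ᶜ + #(a ∪ b)ᶜ = #aᶜ + #bᶜ := by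
      rw [compl_inter, compl_union, card_union_add_card_inter]
    apply le_of_eq
    calc weight p a * weight p b = p ^ (#a + #b) * (1 - p) ^ (#aᶜ + #bᶜ) := by
          rw [weight, weight, pow_add, pow_add]; ring
      _ = p ^ (#(a ∩ b) + #(a ∪ b)) * (1 - p) ^ (#(a ∩ b)ᶜ + #(a ∪ b)ᶜ) := by
          rw [h2, card_inter_add_card_union]
      _ = weight p (a ⊓ b) * weight p (a ⊔ b) := by
          rw [weight, weight, pow_add, pow_add, inf_eq_inter, sup_eq_union]; ring
  rwa [sum_weight, one_mul] at this

/-- **Harris' inequality**. -/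
lemma prob_mul_le_prob_inter (h0 : 0 ≤ p) (h1 : p ≤ 1) {A B : Set (Finset α)}
    (hA : IsUpperSet A) (hB : IsUpperSet B) : prob p A * prob p B ≤ prob p (A ∩ B) := by
  have := mean_mul_le h0 h1 (f := A.indicator 1) (g := B.indicator 1)
    (Set.indicator_nonneg fun _ _ ↦ zero_le_one) (Set.indicator_nonneg fun _ _ ↦ zero_le_one)
    (monotone_indicator hA) (monotone_indicator hB)
  rw [prob, prob, prob, Set.inter_indicator_one]
  exact this

/-- Harris' inequality for an increasing and a decreasing event. -/
lemma prob_inter_le_prob_mul (h0 : 0 ≤ p) (h1 : p ≤ 1) {A B : Set (Finset α)}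
    (hA : IsUpperSet A) (hB : IsLowerSet B) : prob p (A ∩ B) ≤ prob p A * prob p B := by
  have h := prob_mul_le_prob_inter h0 h1 hA hB.compl
  have h2 := prob_add_prob_compl (p := p) B
  have h3 := prob_inter_add_diff (p := p) A B
  rw [Set.sdiff_eq] at h3
  rw [show prob p Bᶜ = 1 - prob p B by linarith] at h
  linarith

/-- Harris' inequality for two decreasing events. -/
lemma prob_mul_le_prob_inter_of_isLowerSet (h0 : 0 ≤ p) (h1 : p ≤ 1) {A B : Set (Finset α)}
    (hA : IsLowerSet A) (hB : IsLowerSet B) : prob p A * prob p B ≤ prob p (A ∩ B) := by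
  have h := prob_inter_le_prob_mul h0 h1 hA.compl hB
  have h2 := prob_add_prob_compl (p := p) A
  have h3 := prob_inter_add_diff (p := p) B A
  rw [Set.sdiff_eq, Set.inter_comm, Set.inter_comm B] at h3
  rw [show prob p Aᶜ = 1 - prob p A by linarith] at h
  linarith

lemma mean_indicator_eq_sum {q : ℝ} (A : Set (Finset α)) (r : Finset α → ℝ)
    (h : ∀ S, weight q S = weight p S * r S) :
    prob q A = mean p (fun S ↦ r S * A.indicator 1 S) := by
  simp [prob, mean, h, mul_assoc]

/-- The probability of a decreasing event decreases with `p`: the likelihood ratio is an increasing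
function of the random set, so that Harris' inequality applies. -/
lemma prob_anti {q : ℝ} (h0 : 0 < p) (hpq : p ≤ q) (hp1 : p < 1) (hq : q ≤ 1)
    {A : Set (Finset α)} (hA : IsLowerSet A) : prob q A ≤ prob p A := by
  set r : Finset α → ℝ := fun S ↦ (q / p) ^ #S * ((1 - q) / (1 - p)) ^ #Sᶜ with hr
  have hp1' : 0 < 1 - p := by linarith
  have ha : 1 ≤ q / p := (one_le_div h0).2 hpq
  have hb0 : 0 ≤ (1 - q) / (1 - p) := div_nonneg (by linarith) hp1'.le
  have hb1 : (1 - q) / (1 - p) ≤ 1 := (div_le_one hp1').2 (by linarith)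
  have hrw : ∀ S, weight q S = weight p S * r S := by
    intro S
    simp only [weight, hr, div_pow]
    field_simp
  have hr0 : 0 ≤ r := fun S ↦ by positivity
  have hrmono : Monotone r := by
    intro S T hST
    have hc : #Tᶜ ≤ #Sᶜ := card_le_card (compl_subset_compl.2 hST)
    exact mul_le_mul (pow_le_pow_right₀ ha (card_le_card hST)) (pow_le_pow_of_le_one hb0 hb1 hc)
      (by positivity) (by positivity)
  have hAc := mean_mul_le h0.le hp1.le hr0 (g := Aᶜ.indicator 1)
    (Set.indicator_nonneg fun _ _ ↦ zero_le_one) hrmono (monotone_indicator hA.compl)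
  rw [← mean_indicator_eq_sum _ r hrw] at hAc
  have hr1 : mean p r = 1 := by
    rw [mean, ← sum_weight (α := α) q]
    exact sum_congr rfl fun S _ ↦ (hrw S).symm
  rw [hr1, one_mul] at hAc
  change prob p Aᶜ ≤ _ at hAc
  have h1 := prob_add_prob_compl (p := p) A
  have h2 := prob_add_prob_compl (p := q) A
  linarith

/-- The lower bound matching Janson's inequality: by Harris' inequality, avoiding the sets is at
least as likely as it would be if they were disjoint. -/
lemma prod_le_prob_avoid (h0 : 0 ≤ p) (h1 : p ≤ 1) {ι : Type*} [DecidableEq ι] (s : Finset ι)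
    (A : ι → Finset α) : ∏ i ∈ s, (1 - p ^ #(A i)) ≤ prob p (avoid s A) := by
  induction s using Finset.induction_on with
  | empty => simp [avoid, prob_univ]
  | insert i s hi ih =>
    have : avoid (insert i s) A = {S | A i ⊆ S}ᶜ ∩ avoid s A := by
      ext S; simp [avoid]
    rw [this, prod_insert hi]
    refine le_trans ?_ (prob_mul_le_prob_inter_of_isLowerSet h0 h1
      (isUpperSet_subset (A i)).compl (isLowerSet_avoid s A))
    have h := prob_add_prob_compl (p := p) {S | A i ⊆ S}
    rw [prob_subset] at h
    rw [show prob p {S | A i ⊆ S}ᶜ = 1 - p ^ #(A i) by linarith]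
    exact mul_le_mul_of_nonneg_left ih (sub_nonneg.2 (pow_le_one₀ h0 h1))

/-- One step of Janson's inequality. The event `A i ⊆ S` is independent of the avoidance of the sets
disjoint from `A i`. For the other sets `A j`, Harris' inequality decouples the increasing event
`A i ∪ A j ⊆ S` from that avoidance. -/
lemma prob_avoid_insert_le (h0 : 0 ≤ p) (h1 : p ≤ 1) {ι : Type*} [DecidableEq ι] (s : Finset ι)
    (A : ι → Finset α) (i : ι) :
    prob p (avoid (insert i s) A) ≤ prob p (avoid s A) *
      Real.exp (-p ^ #(A i) + ∑ j ∈ s with ¬ Disjoint (A i) (A j), p ^ #(A i ∪ A j)) := by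
  set c : ℝ := ∑ j ∈ s with ¬ Disjoint (A i) (A j), p ^ #(A i ∪ A j) with hc
  set D := avoid s A
  set D' := avoid {j ∈ s | Disjoint (A i) (A j)} A
  have hD : prob p D ≤ prob p D' := prob_mono h0 h1 fun S hS j hj ↦ hS j (mem_filter.1 hj).1
  have hDpos := prob_nonneg h0 h1 D
  have hind : prob p ({S | A i ⊆ S} ∩ D') = p ^ #(A i) * prob p D' :=
    prob_subset_inter p _ (insensitive_avoid fun j hj ↦ (mem_filter.1 hj).2)
  have hunion : {S | A i ⊆ S} ∩ D' ⊆ ({S | A i ⊆ S} ∩ D) ∪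
      ⋃ j ∈ {j ∈ s | ¬ Disjoint (A i) (A j)}, ({S | A i ∪ A j ⊆ S} ∩ D') := by
    rintro S ⟨hi, hS⟩
    by_cases h : S ∈ D
    · exact Or.inl ⟨hi, h⟩
    · right
      have : ∃ j ∈ s, A j ⊆ S := by simpa [D, avoid] using h
      obtain ⟨j, hj, hjS⟩ := this
      have hnd : ¬ Disjoint (A i) (A j) := fun hd ↦ hS j (mem_filter.2 ⟨hj, hd⟩) hjS
      exact Set.mem_biUnion (mem_coe.2 (mem_filter.2 ⟨hj, hnd⟩)) ⟨union_subset hi hjS, hS⟩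
  have hle : prob p ({S | A i ⊆ S} ∩ D') ≤ prob p ({S | A i ⊆ S} ∩ D) + c * prob p D' := by
    refine (prob_mono h0 h1 hunion).trans ?_
    have h2 : ∀ X Y : Set (Finset α), prob p (X ∪ Y) ≤ prob p X + prob p Y := by
      intro X Y
      rw [← prob_inter_add_diff (p := p) (X ∪ Y) X, Set.union_inter_cancel_left,
        Set.union_sdiff_left]
      exact add_le_add_right (prob_mono h0 h1 Set.sdiff_subset) _
    refine (h2 _ _).trans (add_le_add_right ((prob_biUnion_le h0 h1 _ _).trans ?_) _)
    rw [hc, sum_mul]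
    refine sum_le_sum fun j _ ↦ ?_
    rw [← prob_subset p (A i ∪ A j)]
    exact prob_inter_le_prob_mul h0 h1 (isUpperSet_subset _) (isLowerSet_avoid _ _)
  have hins : avoid (insert i s) A = D \ {S | A i ⊆ S} := by
    ext S; simp [D, avoid, and_comm]
  have hsplit := prob_inter_add_diff (p := p) D {S | A i ⊆ S}
  rw [hins]
  rw [hind] at hle
  rw [Set.inter_comm] at hsplit
  have hge : (p ^ #(A i) - c) * prob p D ≤ prob p ({S | A i ⊆ S} ∩ D) := by
    -- If the overlaps outweigh `p ^ #(A i)`, the bound is trivial.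
    rcases le_total 0 (p ^ #(A i) - c) with h | h
    · nlinarith
    · exact (mul_nonpos_of_nonpos_of_nonneg h hDpos).trans (prob_nonneg h0 h1 _)
  have hexp := Real.add_one_le_exp (-p ^ #(A i) + c)
  nlinarith

/-- **Janson's inequality**. The sum over overlapping pairs is not halved, as only its order of
magnitude matters below. -/
theorem prob_avoid_le (h0 : 0 ≤ p) (h1 : p ≤ 1) {ι : Type*} [DecidableEq ι] (s : Finset ι)
    (A : ι → Finset α) :
    prob p (avoid s A) ≤ Real.exp (-∑ i ∈ s, p ^ #(A i) +
      ∑ i ∈ s, ∑ j ∈ s with j ≠ i ∧ ¬ Disjoint (A i) (A j), p ^ #(A i ∪ A j)) := by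
  suffices h : ∀ t ⊆ s, prob p (avoid t A) ≤ Real.exp (-∑ i ∈ t, p ^ #(A i) +
      ∑ i ∈ t, ∑ j ∈ s with j ≠ i ∧ ¬ Disjoint (A i) (A j), p ^ #(A i ∪ A j)) from h s subset_rfl
  intro t
  induction t using Finset.induction_on with
  | empty => simp [avoid, prob_univ]
  | insert i t hi ih =>
    intro hts
    refine (prob_avoid_insert_le h0 h1 t A i).trans ?_
    refine (mul_le_mul_of_nonneg_right (ih ((subset_insert i t).trans hts))
      (Real.exp_pos _).le).trans ?_
    rw [← Real.exp_add, sum_insert hi, sum_insert hi]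
    refine Real.exp_le_exp.2 ?_
    have : ∑ j ∈ t with ¬ Disjoint (A i) (A j), p ^ #(A i ∪ A j) ≤
        ∑ j ∈ s with j ≠ i ∧ ¬ Disjoint (A i) (A j), p ^ #(A i ∪ A j) := by
      refine sum_le_sum_of_subset_of_nonneg ?_ fun _ _ _ ↦ pow_nonneg h0 _
      intro j hj
      rw [mem_filter] at hj ⊢
      exact ⟨hts (mem_insert_of_mem hj.1), fun h ↦ hi (h ▸ hj.1), hj.2⟩
    linarith

open Classical in
/-- The second moment method: if the events `B e` are almost uncorrelated and their expected number
is large, then it is unlikely that none of them occurs. -/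
lemma prob_forall_notMem_le (h0 : 0 ≤ p) (h1 : p ≤ 1) {ι : Type*} [DecidableEq ι] (s : Finset ι)
    (B : ι → Set (Finset α)) {η : ℝ} (hη : 0 ≤ η)
    (hB : ∀ i ∈ s, ∀ j ∈ s, i ≠ j → prob p (B i ∩ B j) ≤ (1 + η) * (prob p (B i) * prob p (B j)))
    (hpos : 0 < ∑ i ∈ s, prob p (B i)) :
    prob p {S | ∀ i ∈ s, S ∉ B i} ≤ (∑ i ∈ s, prob p (B i))⁻¹ + η := by
  set M := ∑ i ∈ s, prob p (B i) with hM
  set Y : Finset α → ℝ := fun S ↦ ∑ i ∈ s, (B i).indicator 1 S with hY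
  have hEY : mean p Y = M := mean_sum s _
  have hEY2 : mean p (fun S ↦ Y S * Y S) ≤ M + (1 + η) * M ^ 2 := by
    have h : (fun S ↦ Y S * Y S) =
        fun S ↦ ∑ i ∈ s, ∑ j ∈ s, (B i ∩ B j).indicator 1 S := by
      ext S
      simp only [hY, sum_mul_sum, Set.inter_indicator_one, Pi.mul_apply]
    rw [h, mean_sum]
    have : ∀ i ∈ s, mean p (fun S ↦ ∑ j ∈ s, (B i ∩ B j).indicator 1 S) ≤
        prob p (B i) + (1 + η) * (prob p (B i) * M) := by
      intro i hi
      rw [mean_sum, ← add_sum_erase _ _ hi, Set.inter_self]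
      refine add_le_add le_rfl ?_
      rw [hM, mul_sum, mul_sum]
      refine (sum_le_sum fun j hj ↦ hB i hi j (mem_of_mem_erase hj) (ne_of_mem_erase hj).symm).trans
        ?_
      exact sum_le_sum_of_subset_of_nonneg (erase_subset _ _) fun j _ _ ↦
        mul_nonneg (by linarith) (mul_nonneg (prob_nonneg h0 h1 _) (prob_nonneg h0 h1 _))
    refine (sum_le_sum this).trans (le_of_eq ?_)
    rw [sum_add_distrib, ← mul_sum, ← sum_mul]
    ring
  -- Chebyshev: the mean of `(Y - M) ^ 2` is at least `M ^ 2` times the probability that `Y = 0`.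
  have hle : M ^ 2 * prob p {S | ∀ i ∈ s, S ∉ B i} ≤
      mean p (fun S ↦ Y S * Y S) + (-2 * M) * mean p Y + M ^ 2 := by
    rw [← mean_const (α := α) (p := p) (M ^ 2), prob, mean_const, ← mean_const_mul,
      ← mean_const_mul, ← mean_add]
    nth_rw 2 [← mean_const (α := α) (p := p) (M ^ 2)]
    rw [← mean_add]
    refine mean_mono h0 h1 fun S ↦ ?_
    by_cases hS : S ∈ {S | ∀ i ∈ s, S ∉ B i}
    · have : Y S = 0 := sum_eq_zero fun i hi ↦ by simp [hS i hi]
      simp [hS, this]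
    · simp only [hS, not_false_eq_true, Set.indicator_of_notMem]
      nlinarith [sq_nonneg (Y S - M)]
  rw [hEY] at hle
  have h3 : M ^ 2 * prob p {S | ∀ i ∈ s, S ∉ B i} ≤ M ^ 2 * (M⁻¹ + η) := by
    have : M ^ 2 * (M⁻¹ + η) = M + η * M ^ 2 := by field_simp
    rw [this]
    nlinarith
  exact le_of_mul_le_mul_left h3 (by positivity)

end RandomSubset

/-! ### The binomial random graph as a random set of pairs -/

section Transfer

variable {V : Type*} [Fintype V] [DecidableEq V]

lemma binomialRandom_singleton_eq (p : unitInterval) (G : SimpleGraph V) :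
    SimpleGraph.binomialRandom V p {G} = ENNReal.ofReal (prob (p : ℝ)
      {S : Finset (Sym2 V) | SimpleGraph.fromEdgeSet (S : Set (Sym2 V)) = G}) := by
  have : DecidableRel G.Adj := Classical.decRel _
  set E := G.edgeFinset
  set F : Finset (Sym2 V) := (⊤ : SimpleGraph V).edgeFinset \ E with hF
  have hEsub : E ⊆ (⊤ : SimpleGraph V).edgeFinset := SimpleGraph.edgeFinset_mono le_top
  have hset : {S : Finset (Sym2 V) | SimpleGraph.fromEdgeSet (S : Set (Sym2 V)) = G} =
      {S | E ⊆ S} ∩ ({S | Disjoint F S} ∩ Set.univ) := by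
    ext S
    simp only [Set.mem_ofPred_eq, Set.inter_univ, Set.mem_inter_iff]
    rw [← SimpleGraph.edgeSet_inj, SimpleGraph.edgeSet_fromEdgeSet]
    constructor
    · intro h
      have hm : ∀ e, e ∈ G.edgeSet ↔ e ∈ S ∧ ¬ e.IsDiag := fun e ↦ by rw [← h]; simp
      refine ⟨fun e he ↦ ((hm e).1 (by simpa [E] using he)).1, disjoint_left.2 fun e he heS ↦ ?_⟩
      rw [hF, Finset.mem_sdiff] at he
      exact he.2 (by simpa [E] using (hm e).2 ⟨heS, by simpa using he.1⟩)
    · rintro ⟨h1, h2⟩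
      ext e
      simp only [Set.mem_sdiff, mem_coe]
      constructor
      · rintro ⟨h3, h4⟩
        by_contra h5
        refine disjoint_left.1 h2 (Finset.mem_sdiff.2 ⟨?_, by simpa [E] using h5⟩) h3
        simpa using h4
      · intro h
        exact ⟨h1 (by simpa [E] using h), by simpa using G.not_isDiag_of_mem_edgeSet h⟩
  have hdisj : Insensitive ({S : Finset (Sym2 V) | Disjoint F S} ∩ Set.univ) E := by
    intro x hx S _
    have : x ∉ F := fun h ↦ (Finset.mem_sdiff.1 h).2 hx
    simp [this]
  rw [hset, prob_subset_inter _ _ hdisj, prob_disjoint_inter _ _ fun _ _ _ _ ↦ by simp, prob_univ,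
    mul_one, SimpleGraph.binomialRandom_singleton]
  have hEc : G.edgeSet.ncard = #E := by
    rw [← SimpleGraph.coe_edgeFinset, Set.ncard_coe_finset]
  have hFc : #F = (Nat.card V).choose 2 - #E := by
    rw [hF, card_sdiff_of_subset hEsub, SimpleGraph.card_edgeFinset_top_eq_card_choose_two,
      Nat.card_eq_fintype_card]
  rw [hEc, hFc, ENNReal.ofReal_mul (pow_nonneg p.2.1 _), ENNReal.ofReal_pow p.2.1,
    ENNReal.ofReal_pow (sub_nonneg.2 p.2.2)]
  congr 2
  · rw [ENNReal.ofReal, Real.toNNReal_of_nonneg p.2.1]; rfl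
  · rw [ENNReal.ofReal, Real.toNNReal_of_nonneg (sub_nonneg.2 p.2.2)]; rfl

/-- The binomial random graph is obtained from the `p`-random set of unordered pairs by discarding
the loops. -/
theorem binomialRandom_eq_prob (p : unitInterval) (𝒮 : Set (SimpleGraph V)) :
    SimpleGraph.binomialRandom V p 𝒮 = ENNReal.ofReal (prob (p : ℝ)
      {S : Finset (Sym2 V) | SimpleGraph.fromEdgeSet (S : Set (Sym2 V)) ∈ 𝒮}) := by
  classical
  have : MeasurableSingletonClass (SimpleGraph V) := ⟨fun G ↦ by
    have h := SimpleGraph.measurableEmbedding_edgeSet.measurable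
      (measurableSet_singleton (SimpleGraph.edgeSet G))
    convert h using 1
    ext G'
    simp⟩
  have h1 : SimpleGraph.binomialRandom V p 𝒮 =
      ∑ G ∈ 𝒮.toFinset, SimpleGraph.binomialRandom V p {G} := by
    rw [MeasureTheory.sum_measure_singleton, Set.coe_toFinset]
  simp only [h1, binomialRandom_singleton_eq]
  rw [← ENNReal.ofReal_sum_of_nonneg fun G _ ↦ prob_nonneg p.2.1 p.2.2 _]
  congr 1
  simp only [prob]
  rw [← mean_sum]
  congr 1
  ext S
  simp only [Set.indicator_apply, Set.mem_ofPred_eq, Pi.one_apply, sum_ite_eq, Set.mem_toFinset]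

end Transfer

/-! ### Copies of a graph -/

section Copies

variable {W V : Type*} [Fintype W]

/-- The edge set of the image of `H` under a map of the vertices. -/
def imageEdges (H : SimpleGraph W) [DecidableRel H.Adj] [DecidableEq V] (f : W → V) :
    Finset (Sym2 V) :=
  H.edgeFinset.image (Sym2.map f)

variable (V) in
/-- The edge sets of the copies of `H` in the complete graph on `V`. A graph without isolated
vertices is determined by its edge set. -/
def copies [DecidableEq W] (H : SimpleGraph W) [DecidableRel H.Adj] [Fintype V] [DecidableEq V] :
    Finset (Finset (Sym2 V)) :=
  ({f : W → V | Function.Injective f} : Finset (W → V)).image (imageEdges H)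

/-- The edge sets of the copies of `H` that contain the pair `e`. -/
def copiesThrough [DecidableEq W] (H : SimpleGraph W) [DecidableRel H.Adj] [Fintype V]
    [DecidableEq V] (e : Sym2 V) : Finset (Finset (Sym2 V)) :=
  {E ∈ copies V H | e ∈ E}

variable {H : SimpleGraph W} [DecidableRel H.Adj] [DecidableEq V]

lemma card_imageEdges {f : W → V} (hf : Function.Injective f) :
    #(imageEdges H f) = #H.edgeFinset :=
  card_image_of_injective _ (Sym2.map.injective hf)

lemma not_isDiag_of_mem_imageEdges {f : W → V} (hf : Function.Injective f) {e : Sym2 V}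
    (he : e ∈ imageEdges H f) : ¬ e.IsDiag := by
  obtain ⟨d, hd, rfl⟩ := mem_image.1 he
  rw [Sym2.isDiag_map hf]
  exact H.not_isDiag_of_mem_edgeSet (by simpa using hd)

lemma edgeSet_toSubgraph {G : SimpleGraph V} (c : H.Copy G) :
    c.toSubgraph.edgeSet = (imageEdges H c : Set (Sym2 V)) := by
  ext e
  simp [imageEdges, SimpleGraph.Copy.toSubgraph, SimpleGraph.Subgraph.edgeSet_map]

variable [DecidableEq W] [Fintype V]

lemma mem_copies {E : Finset (Sym2 V)} :
    E ∈ copies V H ↔ ∃ f : W → V, Function.Injective f ∧ imageEdges H f = E := by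
  simp [copies]

lemma mem_copiesThrough {e : Sym2 V} {E : Finset (Sym2 V)} :
    E ∈ copiesThrough H e ↔ E ∈ copies V H ∧ e ∈ E := by
  simp [copiesThrough]

lemma card_of_mem_copies {E : Finset (Sym2 V)} (hE : E ∈ copies V H) : #E = #H.edgeFinset := by
  obtain ⟨f, hf, rfl⟩ := mem_copies.1 hE
  exact card_imageEdges hf

/-- The event that the pair `e` is an edge lying in no copy of `H`. -/
def badEdge (H : SimpleGraph W) [DecidableRel H.Adj] (e : Sym2 V) : Set (Finset (Sym2 V)) :=
  {S | e ∈ S ∧ ∀ E ∈ copiesThrough H e, ¬ E ⊆ S}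

lemma fromEdgeSet_mem_edgesInCopies_iff (S : Finset (Sym2 V)) :
    SimpleGraph.fromEdgeSet (S : Set (Sym2 V)) ∈ edgesInCopies H V ↔
      ∀ e ∈ (⊤ : SimpleGraph V).edgeFinset, S ∉ badEdge H e := by
  set G := SimpleGraph.fromEdgeSet (S : Set (Sym2 V)) with hG
  have hmem : ∀ e, e ∈ G.edgeSet ↔ e ∈ S ∧ ¬ e.IsDiag := fun e ↦ by simp [hG]
  simp only [edgesInCopies, Set.mem_ofPred_eq, badEdge, mem_copiesThrough, not_and, not_forall,
    not_not, SimpleGraph.mem_edgeFinset]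
  have htop : ∀ e : Sym2 V, e ∈ (⊤ : SimpleGraph V).edgeSet ↔ ¬ e.IsDiag := fun e ↦ by simp
  constructor
  · intro h e he heS
    obtain ⟨K, hK, heK⟩ := h e ((hmem e).2 ⟨heS, (htop e).1 he⟩)
    have hK' : K ∈ {B : G.Subgraph | Nonempty (H ≃g B.coe)} := hK
    rw [← SimpleGraph.Copy.range_toSubgraph] at hK'
    obtain ⟨c, rfl⟩ := hK'
    rw [edgeSet_toSubgraph] at heK
    refine ⟨imageEdges H c, ⟨mem_copies.2 ⟨c, c.injective, rfl⟩, heK⟩, fun x hx ↦ ?_⟩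
    have : x ∈ c.toSubgraph.edgeSet := by rw [edgeSet_toSubgraph]; exact hx
    exact ((hmem x).1 (SimpleGraph.Subgraph.edgeSet_subset _ this)).1
  · intro h e he
    obtain ⟨heS, hed⟩ := (hmem e).1 he
    obtain ⟨E, ⟨hE, heE⟩, hES⟩ := h e ((htop e).2 hed) heS
    obtain ⟨f, hf, rfl⟩ := mem_copies.1 hE
    have hadj : ∀ {a b}, H.Adj a b → G.Adj (f a) (f b) := by
      intro a b hab
      have : s(f a, f b) ∈ imageEdges H f := mem_image.2 ⟨s(a, b), by simpa using hab, rfl⟩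
      exact (hmem _).2 ⟨hES this, not_isDiag_of_mem_imageEdges hf this⟩
    let c : H.Copy G := ⟨⟨f, hadj⟩, hf⟩
    refine ⟨c.toSubgraph, ⟨c.isoToSubgraph⟩, ?_⟩
    rw [edgeSet_toSubgraph]
    exact heE

/-- The probability that every edge of the binomial random graph lies in a copy of `H`. -/
lemma binomialRandom_edgesInCopies (p : unitInterval) :
    SimpleGraph.binomialRandom V p (edgesInCopies H V) = ENNReal.ofReal (prob (p : ℝ)
      {S | ∀ e ∈ (⊤ : SimpleGraph V).edgeFinset, S ∉ badEdge H e}) := by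
  rw [binomialRandom_eq_prob]
  simp only [fromEdgeSet_mem_edgesInCopies_iff]

end Copies

/-! ### Strictly balanced graphs -/

section Balanced

variable {W : Type*}

lemma twoDensity_top_coe (H : SimpleGraph W) :
    twoDensity (⊤ : H.Subgraph).coe = twoDensity H := by
  have h1 : Nat.card (⊤ : H.Subgraph).verts = Nat.card W :=
    Nat.card_congr SimpleGraph.Subgraph.topIso.toEquiv
  have h2 : (⊤ : H.Subgraph).coe.edgeSet.ncard = H.edgeSet.ncard :=
    Nat.card_congr SimpleGraph.Subgraph.topIso.mapEdgeSet
  rw [twoDensity, twoDensity, h1, h2]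

lemma maxTwoDensity_eq {H : SimpleGraph W} (hbal : IsStrictlyTwoBalanced H) :
    maxTwoDensity H = twoDensity H := by
  have hle : ∀ K : H.Subgraph, twoDensity K.coe ≤ twoDensity H := by
    intro K
    by_cases hK : K = ⊤
    · rw [hK, twoDensity_top_coe]
    · exact (hbal.2 K hK).le
  refine le_antisymm (ciSup_le hle) ?_
  rw [← twoDensity_top_coe H]
  exact le_ciSup (f := fun K : H.Subgraph ↦ twoDensity K.coe) ⟨_, Set.forall_mem_range.2 hle⟩ ⊤

variable [Fintype W] {H : SimpleGraph W}

lemma three_le_card (hbal : IsStrictlyTwoBalanced H) : 3 ≤ Fintype.card W := by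
  simpa [Nat.card_eq_fintype_card] using hbal.1

/-- By the orbit-stabilizer theorem, the orbit of `(a, b)` contributes its size divided by
`|Aut H|` to `ρ(H)`. -/
lemma rho_eq_card_dart_div (H : SimpleGraph W) :
    rho H = (Nat.card H.Dart : ℝ) / Nat.card (H ≃g H) := by
  classical
  have : Finite (H ≃g H) := Finite.of_injective _ DFunLike.coe_injective
  have hpos : (0 : ℝ) < Nat.card (H ≃g H) := by exact_mod_cast Nat.card_pos
  let _ : MulAction (H ≃g H) H.Dart :=
    { smul φ d := φ.toHom.mapDart d
      one_smul d := rfl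
      mul_smul φ ψ d := rfl }
  have hfst : ∀ (φ : H ≃g H) (d : H.Dart), (φ • d).fst = φ d.fst := fun _ _ ↦ rfl
  have hsnd : ∀ (φ : H ≃g H) (d : H.Dart), (φ • d).snd = φ d.snd := fun _ _ ↦ rfl
  have hext : ∀ (φ : H ≃g H) (d d' : H.Dart),
      φ • d = d' ↔ φ d.fst = d'.fst ∧ φ d.snd = d'.snd := by
    intro φ d d'
    rw [SimpleGraph.Dart.ext_iff, Prod.ext_iff]
    exact Iff.rfl
  have key : ∀ q : Quotient (orderedEdgeSetoid H),
      1 / (autFixing H q.out.fst q.out.snd : ℝ) =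
        (Nat.card {d // (Quotient.mk _ d : Quotient (orderedEdgeSetoid H)) = q} : ℝ) /
          Nat.card (H ≃g H) := by
    intro q
    have h1 : Nat.card {d // (Quotient.mk _ d : Quotient (orderedEdgeSetoid H)) = q} =
        Nat.card (MulAction.orbit (H ≃g H) q.out) := by
      refine Nat.card_congr (Equiv.subtypeEquivRight fun d ↦ ?_)
      rw [eq_comm, Quotient.eq_mk_iff_out, MulAction.mem_orbit_iff]
      exact exists_congr fun φ ↦ (hext φ _ _).symm
    have h2 : autFixing H q.out.fst q.out.snd =
        Nat.card (MulAction.stabilizer (H ≃g H) q.out) := by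
      refine Nat.card_congr (Equiv.subtypeEquivRight fun φ ↦ ?_)
      rw [MulAction.mem_stabilizer_iff, hext]
    have : Fintype (H ≃g H) := Fintype.ofFinite _
    have : Fintype (MulAction.orbit (H ≃g H) q.out) := Fintype.ofFinite _
    have : Fintype (MulAction.stabilizer (H ≃g H) q.out) := Fintype.ofFinite _
    have h3 := MulAction.card_orbit_mul_card_stabilizer_eq_card_group (H ≃g H) q.out
    simp only [← Nat.card_eq_fintype_card] at h3
    rw [h1, h2, ← h3]
    rw [← h3] at hpos
    push_cast at hpos ⊢
    have ho := left_ne_zero_of_mul hpos.ne'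
    have hs := right_ne_zero_of_mul hpos.ne'
    field_simp
  have : Fintype (Quotient (orderedEdgeSetoid H)) := Fintype.ofFinite _
  rw [rho, finsum_eq_sum_of_fintype, sum_congr rfl fun q _ ↦ key q, ← sum_div]
  congr 1
  rw [← Nat.cast_sum, ← Nat.card_sigma]
  exact_mod_cast Nat.card_congr (Equiv.sigmaFiberEquiv _)

variable [DecidableRel H.Adj]

lemma rho_eq (H : SimpleGraph W) [DecidableRel H.Adj] :
    rho H = 2 * (#H.edgeFinset : ℝ) / Nat.card (H ≃g H) := by
  classical
  rw [rho_eq_card_dart_div, Nat.card_eq_fintype_card, SimpleGraph.dart_card_eq_twice_card_edges]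
  push_cast
  rfl

lemma ncard_edgeSet_eq : H.edgeSet.ncard = #H.edgeFinset := by
  rw [← SimpleGraph.coe_edgeFinset, Set.ncard_coe_finset]

lemma maxTwoDensity_eq_div (hbal : IsStrictlyTwoBalanced H) :
    maxTwoDensity H = ((#H.edgeFinset : ℝ) - 1) / ((Fintype.card W : ℝ) - 2) := by
  rw [maxTwoDensity_eq hbal, twoDensity, if_pos hbal.1, ncard_edgeSet_eq, Nat.card_eq_fintype_card]

lemma card_le_card_edgeFinset_add_one (hconn : H.Connected) :
    Fintype.card W ≤ #H.edgeFinset + 1 := by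
  have := hconn.card_vert_le_card_edgeSet_add_one
  rwa [Nat.card_eq_fintype_card, Nat.card_coe_set_eq, ncard_edgeSet_eq] at this

variable [DecidableEq W]

/-- The vertices incident with the edges in `A`. -/
def incidentVerts (A : Finset (Sym2 W)) : Finset W := {w | ∃ e ∈ A, w ∈ e}

lemma three_le_card_incidentVerts {A : Finset (Sym2 W)} (hA : A ⊆ H.edgeFinset) (h2 : 2 ≤ #A) :
    3 ≤ #(incidentVerts A) := by
  obtain ⟨e, he, f, hf, hne⟩ := one_lt_card.1 h2
  have hdiag : ∀ x ∈ A, #x.toFinset = 2 := fun x hx ↦ Sym2.card_toFinset_of_not_isDiag _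
    (H.not_isDiag_of_mem_edgeSet (by simpa using hA hx))
  have hsub : ∀ x ∈ A, x.toFinset ⊆ incidentVerts A := fun x hx w hw ↦ by
    simp only [incidentVerts, mem_filter, mem_univ, true_and]
    exact ⟨x, hx, by simpa using hw⟩
  by_contra hlt
  have h1 := eq_of_subset_of_card_le (hsub e he) (by rw [hdiag e he]; omega)
  have h2 := eq_of_subset_of_card_le (hsub f hf) (by rw [hdiag f hf]; omega)
  exact hne (Sym2.ext fun w ↦ by rw [← Sym2.mem_toFinset, h1, ← h2, Sym2.mem_toFinset])

/-- Strict balancedness, for the subgraph spanned by a proper set of at least two edges. -/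
lemma density_lt (hbal : IsStrictlyTwoBalanced H) {A : Finset (Sym2 W)} (hA : A ⊂ H.edgeFinset)
    (h2 : 2 ≤ #A) :
    ((#A : ℝ) - 1) * ((Fintype.card W : ℝ) - 2) <
      ((#H.edgeFinset : ℝ) - 1) * ((#(incidentVerts A) : ℝ) - 2) := by
  have hmem : ∀ e ∈ A, e ∈ H.edgeSet := fun e he ↦ by simpa using hA.1 he
  let K : H.Subgraph :=
    { verts := incidentVerts A
      Adj := fun a b ↦ s(a, b) ∈ A
      adj_sub := fun h ↦ by simpa using hmem _ h
      edge_vert := fun {a b} h ↦ by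
        simp only [incidentVerts, coe_filter, mem_univ, true_and, Set.mem_ofPred_eq]
        exact ⟨_, h, Sym2.mem_mk_left a b⟩
      symm := ⟨fun a b h ↦ by rwa [Sym2.eq_swap]⟩ }
  have hKe : K.edgeSet = A := by
    ext e
    induction e with
    | _ a b => simp [K]
  have hKtop : K ≠ ⊤ := by
    intro h
    have h1 : (A : Set (Sym2 W)) = H.edgeSet := by
      rw [← hKe, h, SimpleGraph.Subgraph.edgeSet_top]
    refine hA.ne (coe_injective ?_)
    rw [h1, SimpleGraph.coe_edgeFinset]
  have h := hbal.2 K hKtop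
  have hv : Nat.card K.verts = #(incidentVerts A) := by
    change Nat.card (incidentVerts A : Set W) = _
    rw [Nat.card_coe_set_eq, Set.ncard_coe_finset]
  have he : K.coe.edgeSet.ncard = #A := by
    rw [← Set.ncard_coe_finset, ← hKe, ← SimpleGraph.Subgraph.image_coe_edgeSet_coe,
      Set.ncard_image_of_injective _ (Sym2.map.injective Subtype.val_injective)]
  have h3 := three_le_card_incidentVerts hA.1 h2
  rw [twoDensity, twoDensity, if_pos hbal.1, hv, if_pos h3, he, ncard_edgeSet_eq,
    Nat.card_eq_fintype_card, div_lt_div_iff₀] at h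
  · exact h
  · have : (3 : ℝ) ≤ #(incidentVerts A) := by exact_mod_cast h3
    linarith
  · have : (3 : ℝ) ≤ Fintype.card W := by exact_mod_cast three_le_card hbal
    linarith

/-- The only strictly balanced connected graph with a vertex of degree one is the path with three
vertices: deleting the vertex from a larger graph would not decrease the density. -/
lemma card_of_pendant (hbal : IsStrictlyTwoBalanced H) (hconn : H.Connected) {d : Sym2 W}
    (hd : d ∈ H.edgeFinset) {w : W} (hwd : w ∈ d) (hw : ∀ e ∈ H.edgeFinset, w ∈ e → e = d) :
    Fintype.card W = 3 ∧ #H.edgeFinset = 2 := by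
  have hv := three_le_card hbal
  have he := card_le_card_edgeFinset_add_one hconn
  suffices h : #H.edgeFinset ≤ 2 by omega
  by_contra! hlt
  have hc : #(H.edgeFinset.erase d) + 1 = #H.edgeFinset := card_erase_add_one hd
  have h := density_lt hbal (erase_ssubset hd) (by omega)
  have hsub : incidentVerts (H.edgeFinset.erase d) ⊆ univ.erase w := by
    intro a ha
    simp only [incidentVerts, mem_filter, mem_univ, true_and] at ha
    obtain ⟨e, he, hae⟩ := ha
    refine mem_erase.2 ⟨?_, mem_univ _⟩
    rintro rfl
    exact (mem_erase.1 he).1 (hw e (mem_erase.1 he).2 hae)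
  have hvc : #(incidentVerts (H.edgeFinset.erase d)) + 1 ≤ Fintype.card W := by
    have := card_le_card hsub
    rw [card_erase_of_mem (mem_univ _), card_univ] at this
    omega
  have hc' : (#(H.edgeFinset.erase d) : ℝ) + 1 = #H.edgeFinset := by exact_mod_cast hc
  have hvc' : (#(incidentVerts (H.edgeFinset.erase d)) : ℝ) + 1 ≤ Fintype.card W := by
    exact_mod_cast hvc
  have he' : (Fintype.card W : ℝ) ≤ #H.edgeFinset + 1 := by exact_mod_cast he
  have hlt' : (3 : ℝ) ≤ #H.edgeFinset := by exact_mod_cast hlt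
  nlinarith

end Balanced

/-! ### Counting copies -/

section Counting

variable {W V : Type*} [Fintype W]

lemma exists_mem_edge {H : SimpleGraph W} (hbal : IsStrictlyTwoBalanced H)
    (hconn : H.Connected) (w : W) : ∃ u, H.Adj w u := by
  have : Nontrivial W := Fintype.one_lt_card_iff_nontrivial.1 (by have := three_le_card hbal; omega)
  exact hconn.preconnected.exists_adj_of_nontrivial w

section

variable {H : SimpleGraph W} [DecidableRel H.Adj] [DecidableEq V]

lemma mk_mem_imageEdges_iff {f : W → V} (hf : Function.Injective f) {a b : W} :
    s(f a, f b) ∈ imageEdges H f ↔ H.Adj a b := by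
  rw [imageEdges, mem_image]
  constructor
  · rintro ⟨d, hd, h⟩
    have : d = s(a, b) := Sym2.map.injective hf h
    simpa [this] using hd
  · intro h
    exact ⟨s(a, b), by simpa using h, rfl⟩

/-- Two embeddings of `H` with the same image differ by an automorphism of `H`. As images are
recorded by their edges only, this requires that `H` has no isolated vertices. -/
lemma exists_comp_eq (hbal : IsStrictlyTwoBalanced H) (hconn : H.Connected) {f g : W → V}
    (hf : Function.Injective f) (hg : Function.Injective g)
    (hfg : imageEdges H g = imageEdges H f) : ∃ φ : H ≃g H, f ∘ φ = g := by
  have h1 : ∀ w, ∃ u, f u = g w := by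
    intro w
    obtain ⟨u, hu⟩ := exists_mem_edge hbal hconn w
    have h2 := (mk_mem_imageEdges_iff hg).2 hu
    rw [hfg] at h2
    obtain ⟨d, -, hd⟩ := mem_image.1 h2
    have h3 : g w ∈ Sym2.map f d := by rw [hd]; exact Sym2.mem_mk_left _ _
    obtain ⟨u, -, hu⟩ := Sym2.mem_map.1 h3
    exact ⟨u, hu⟩
  choose φ hφ using h1
  have hinj : Function.Injective φ := fun a b hab ↦ hg (by rw [← hφ, ← hφ, hab])
  let e : W ≃ W := Equiv.ofBijective φ (Finite.injective_iff_bijective.1 hinj)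
  refine ⟨⟨e, fun {a b} ↦ ?_⟩, funext hφ⟩
  rw [← mk_mem_imageEdges_iff hf, ← mk_mem_imageEdges_iff hg, hfg]
  change s(f (φ a), f (φ b)) ∈ _ ↔ _
  rw [hφ, hφ]

lemma imageEdges_comp (f : W → V) (φ : H ≃g H) : imageEdges H (f ∘ φ) = imageEdges H f := by
  ext e
  simp only [imageEdges, mem_image]
  constructor
  · rintro ⟨d, hd, rfl⟩
    refine ⟨Sym2.map φ d, ?_, by rw [Sym2.map_map]⟩
    induction d with
    | _ a b => simpa [φ.map_adj_iff] using hd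
  · rintro ⟨d, hd, rfl⟩
    refine ⟨Sym2.map φ.symm d, ?_, ?_⟩
    · induction d with
      | _ a b => simpa [φ.symm.map_adj_iff] using hd
    · rw [Sym2.map_map]
      congr 1
      ext w
      simp

end

variable [DecidableEq W] [Fintype V] [DecidableEq V]

lemma card_maps_into (S : Finset W) (U : Finset V) :
    #{f : W → V | ∀ w ∈ S, f w ∈ U} = #U ^ #S * Fintype.card V ^ (Fintype.card W - #S) := by
  have : ({f : W → V | ∀ w ∈ S, f w ∈ U} : Finset (W → V)) =
      Fintype.piFinset fun w ↦ if w ∈ S then U else univ := by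
    ext f
    simp only [mem_filter, mem_univ, true_and, Fintype.mem_piFinset]
    refine forall_congr' fun w ↦ ?_
    split_ifs with h <;> simp [h]
  rw [this, Fintype.card_piFinset, ← prod_mul_prod_compl S, prod_congr rfl fun w hw ↦ by
    rw [if_pos hw], prod_congr (s₁ := Sᶜ) rfl fun w hw ↦ by rw [if_neg (mem_compl.1 hw)]]
  simp [card_compl]

/-- There are `O(n ^ (v - k))` maps sending at least `k` vertices into a given small set. -/
lemma card_maps_many_into (k : ℕ) (U : Finset V) :
    #{f : W → V | k ≤ #{w | f w ∈ U}} ≤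
      2 ^ Fintype.card W * (#U ^ k * Fintype.card V ^ (Fintype.card W - k)) := by
  have hsub : ({f : W → V | k ≤ #{w | f w ∈ U}} : Finset (W → V)) ⊆
      (powersetCard k (univ : Finset W)).biUnion fun S ↦ {f : W → V | ∀ w ∈ S, f w ∈ U} := by
    intro f hf
    obtain ⟨S, hS, hSk⟩ := exists_subset_card_eq (mem_filter.1 hf).2
    simp only [mem_biUnion, mem_powersetCard, mem_filter, mem_univ, true_and]
    exact ⟨S, ⟨subset_univ _, hSk⟩, fun w hw ↦ by simpa using hS hw⟩
  refine (card_le_card hsub).trans (card_biUnion_le.trans ?_)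
  rw [sum_congr rfl fun S hS ↦ by rw [card_maps_into, (mem_powersetCard.1 hS).2], sum_const,
    smul_eq_mul, card_powersetCard, card_univ]
  exact Nat.mul_le_mul_right _ (Nat.choose_le_two_pow _ _)

variable {H : SimpleGraph W} [DecidableRel H.Adj]

/-- The embeddings of `H` with a given image are as many as the automorphisms of `H`. -/
lemma card_copiesThrough_mul (hbal : IsStrictlyTwoBalanced H) (hconn : H.Connected) (e : Sym2 V) :
    #(copiesThrough H e) * Nat.card (H ≃g H) =
      #{f : W → V | Function.Injective f ∧ e ∈ imageEdges H f} := by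
  have hmaps : Set.MapsTo (imageEdges H)
      ({f : W → V | Function.Injective f ∧ e ∈ imageEdges H f} : Finset (W → V))
      (copiesThrough H e : Set (Finset (Sym2 V))) := by
    intro f hf
    simp only [coe_filter, mem_univ, true_and, Set.mem_ofPred_eq] at hf
    exact mem_coe.2 (mem_copiesThrough.2 ⟨mem_copies.2 ⟨f, hf.1, rfl⟩, hf.2⟩)
  rw [card_eq_sum_card_fiberwise hmaps, sum_congr rfl (g := fun _ ↦ Nat.card (H ≃g H)),
    sum_const, smul_eq_mul]
  intro E hE
  obtain ⟨hE, heE⟩ := mem_copiesThrough.1 hE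
  obtain ⟨f, hf, rfl⟩ := mem_copies.1 hE
  rw [← Nat.card_eq_finsetCard]
  symm
  refine Nat.card_congr (Equiv.ofBijective (fun φ ↦ ⟨f ∘ φ, ?_⟩) ⟨?_, ?_⟩)
  · simp only [mem_filter, mem_univ, true_and]
    exact ⟨⟨hf.comp φ.injective, by rwa [imageEdges_comp]⟩, imageEdges_comp f φ⟩
  · intro φ ψ h
    have h' : f ∘ φ = f ∘ ψ := congrArg Subtype.val h
    exact DFunLike.coe_injective (hf.comp_left h')
  · rintro ⟨g, hg⟩
    simp only [mem_filter, mem_univ, true_and] at hg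
    obtain ⟨φ, hφ⟩ := exists_comp_eq hbal hconn hf hg.1.1 hg.2
    exact ⟨φ, Subtype.ext hφ⟩

lemma card_injective_through (x y : V) :
    #{f : W → V | Function.Injective f ∧ s(x, y) ∈ imageEdges H f} =
      ∑ d : H.Dart, #{f : W → V | Function.Injective f ∧ f d.fst = x ∧ f d.snd = y} := by
  rw [← card_biUnion]
  · congr 1
    ext f
    simp only [mem_filter, mem_univ, true_and, mem_biUnion]
    constructor
    · rintro ⟨hf, h⟩
      obtain ⟨d, hd, h⟩ := mem_image.1 h
      induction d with
      | _ a b =>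
        have hab : H.Adj a b := by simpa using hd
        rw [Sym2.map_mk, Sym2.eq_iff] at h
        rcases h with h | h
        · exact ⟨⟨(a, b), hab⟩, hf, h⟩
        · exact ⟨⟨(b, a), hab.symm⟩, hf, h.2, h.1⟩
    · rintro ⟨d, hf, h1, h2⟩
      refine ⟨hf, ?_⟩
      rw [← h1, ← h2, mk_mem_imageEdges_iff hf]
      exact d.adj
  · intro d _ d' _ hne
    refine disjoint_left.2 fun f hf hf' ↦ hne ?_
    simp only [mem_filter, mem_univ, true_and] at hf hf'
    refine SimpleGraph.Dart.ext _ _ (Prod.ext (hf.1 ?_) (hf.1 ?_))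
    · exact hf.2.1.trans hf'.2.1.symm
    · exact hf.2.2.trans hf'.2.2.symm

lemma card_injective_edge_le {a b : W} (hab : a ≠ b) (x y : V) :
    #{f : W → V | Function.Injective f ∧ f a = x ∧ f b = y} ≤
      Fintype.card V ^ (Fintype.card W - 2) := by
  have hsub : ({f : W → V | Function.Injective f ∧ f a = x ∧ f b = y} : Finset (W → V)) ⊆
      Fintype.piFinset fun w ↦ if w = a then {x} else if w = b then {y} else univ := by
    intro f hf
    simp only [mem_filter, mem_univ, true_and] at hf
    rw [Fintype.mem_piFinset]
    intro w
    split_ifs with h1 h2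
    · simp [h1, hf.2.1]
    · simp [h2, hf.2.2]
    · simp
  refine (card_le_card hsub).trans (le_of_eq ?_)
  rw [Fintype.card_piFinset, ← mul_prod_erase univ _ (mem_univ a),
    ← mul_prod_erase (univ.erase a) _ (mem_erase.2 ⟨hab.symm, mem_univ b⟩),
    prod_congr rfl (g := fun _ ↦ Fintype.card V)]
  · simp [hab.symm, Nat.sub_sub]
  · intro w hw
    rw [if_neg (by simp_all), if_neg (by simp_all), card_univ]

lemma le_card_injective_edge {a b : W} (hab : a ≠ b) {x y : V} (hxy : x ≠ y) :
    (Fintype.card V - Fintype.card W) ^ (Fintype.card W - 2) ≤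
      #{f : W → V | Function.Injective f ∧ f a = x ∧ f b = y} := by
  have hW : Fintype.card {w : W // w ≠ a ∧ w ≠ b} = Fintype.card W - 2 := by
    rw [Fintype.card_subtype]
    have : ({w : W | w ≠ a ∧ w ≠ b} : Finset W) = {a, b}ᶜ := by ext; simp
    rw [this, card_compl, card_pair hab]
  have hV : Fintype.card {z : V // z ≠ x ∧ z ≠ y} = Fintype.card V - 2 := by
    rw [Fintype.card_subtype]
    have : ({z : V | z ≠ x ∧ z ≠ y} : Finset V) = {x, y}ᶜ := by ext; simp
    rw [this, card_compl, card_pair hxy]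
  have hcard : (Fintype.card V - Fintype.card W) ^ (Fintype.card W - 2) ≤
      Fintype.card ({w : W // w ≠ a ∧ w ≠ b} ↪ {z : V // z ≠ x ∧ z ≠ y}) := by
    rw [Fintype.card_embedding_eq, hW, hV]
    have h : Fintype.card V - Fintype.card W ≤ Fintype.card V - 2 + 1 - (Fintype.card W - 2) := by
      have := Fintype.one_lt_card_iff.2 ⟨a, b, hab⟩
      omega
    exact (Nat.pow_le_pow_left h _).trans (Nat.pow_sub_le_descFactorial _ _)
  refine hcard.trans ?_
  rw [← card_univ]
  -- Every embedding of the remaining vertices extends by `a ↦ x` and `b ↦ y`.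
  refine card_le_card_of_injOn
    (fun g w ↦ if h : w ≠ a ∧ w ≠ b then (g ⟨w, h⟩ : V) else if w = a then x else y) ?_ ?_
  · intro g _
    simp only [coe_filter, mem_univ, true_and, Set.mem_ofPred_eq]
    refine ⟨?_, by simp, by simp [hab.symm]⟩
    have hg : ∀ u, (g u : V) ≠ x ∧ (g u : V) ≠ y := fun u ↦ (g u).2
    intro w w' h
    by_cases h1 : w ≠ a ∧ w ≠ b <;> by_cases h2 : w' ≠ a ∧ w' ≠ b
    · simp only [h1, h2, ne_eq, not_false_eq_true, and_self, dite_true] at h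
      exact congrArg Subtype.val (g.injective (Subtype.val_injective h))
    · have := hg ⟨w, h1⟩
      grind
    · have := hg ⟨w', h2⟩
      grind
    · grind
  · intro g _ g' _ h
    ext u
    have := congrFun h u
    simpa [u.2] using this

/-- `|copies through e| ≤ ρ n ^ (v - 2)`. -/
lemma card_copiesThrough_le (hbal : IsStrictlyTwoBalanced H) (hconn : H.Connected) {e : Sym2 V}
    (he : ¬ e.IsDiag) : (#(copiesThrough H e) : ℝ) ≤
      rho H * (Fintype.card V : ℝ) ^ (Fintype.card W - 2) := by
  have : Finite (H ≃g H) := Finite.of_injective _ DFunLike.coe_injective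
  have hpos : (0 : ℝ) < Nat.card (H ≃g H) := by exact_mod_cast Nat.card_pos
  rw [rho_eq_card_dart_div, div_mul_eq_mul_div, le_div_iff₀ hpos]
  norm_cast
  rw [card_copiesThrough_mul hbal hconn]
  induction e with
  | _ x y =>
    rw [card_injective_through, Nat.card_eq_fintype_card, ← card_univ]
    exact sum_le_card_nsmul _ _ _ fun d _ ↦ card_injective_edge_le d.adj.ne x y

lemma le_card_copiesThrough (hbal : IsStrictlyTwoBalanced H) (hconn : H.Connected) {e : Sym2 V}
    (he : ¬ e.IsDiag) (hV : Fintype.card W ≤ Fintype.card V) :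
    rho H * ((Fintype.card V : ℝ) - Fintype.card W) ^ (Fintype.card W - 2) ≤
      #(copiesThrough H e) := by
  have : Finite (H ≃g H) := Finite.of_injective _ DFunLike.coe_injective
  have hpos : (0 : ℝ) < Nat.card (H ≃g H) := by exact_mod_cast Nat.card_pos
  rw [rho_eq_card_dart_div, div_mul_eq_mul_div, div_le_iff₀ hpos, ← Nat.cast_sub hV]
  norm_cast
  rw [card_copiesThrough_mul hbal hconn]
  induction e with
  | _ x y =>
    have hxy : x ≠ y := by simpa using he
    rw [card_injective_through, Nat.card_eq_fintype_card, ← card_univ]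
    exact card_nsmul_le_sum _ _ _ fun d _ ↦ le_card_injective_edge d.adj.ne hxy

/-- The copies of `H` through `e` that meet `f` in a vertex outside `e`. -/
def copiesNear (H : SimpleGraph W) [DecidableRel H.Adj] (e f : Sym2 V) :
    Finset (Finset (Sym2 V)) :=
  {E ∈ copiesThrough H e | ∃ z ∈ f, z ∉ e ∧ ∃ g ∈ E, z ∈ g}

lemma mem_copiesNear {e f : Sym2 V} {E : Finset (Sym2 V)} : E ∈ copiesNear H e f ↔
    E ∈ copiesThrough H e ∧ ∃ z ∈ f, z ∉ e ∧ ∃ g ∈ E, z ∈ g := by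
  simp [copiesNear]

/-- Being near `f` fixes a third vertex of the copy, which costs a factor `n`. -/
lemma card_copiesNear_le {e f : Sym2 V} (he : ¬ e.IsDiag) :
    #(copiesNear H e f) ≤
      2 ^ Fintype.card W * (4 ^ 3 * Fintype.card V ^ (Fintype.card W - 3)) := by
  set U : Finset V := e.toFinset ∪ f.toFinset
  have hU : #U ≤ 4 := by
    have h1 : ∀ g : Sym2 V, #g.toFinset ≤ 2 := fun g ↦ by
      rw [Sym2.card_toFinset]
      split_ifs <;> simp
    exact (card_union_le _ _).trans (by have := h1 e; have := h1 f; omega)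
  have hsub : copiesNear H e f ⊆ ({g : W → V | 3 ≤ #{w | g w ∈ U}} : Finset (W → V)).image
      (imageEdges H) := by
    intro E hE
    obtain ⟨hE, z, hzf, hze, d, hd, hzd⟩ := mem_copiesNear.1 hE
    obtain ⟨hE, heE⟩ := mem_copiesThrough.1 hE
    obtain ⟨g, hg, rfl⟩ := mem_copies.1 hE
    refine mem_image_of_mem _ (mem_filter.2 ⟨mem_univ _, ?_⟩)
    have h3 : #(insert z e.toFinset) = 3 := by
      rw [card_insert_of_notMem (by simpa using hze), Sym2.card_toFinset_of_not_isDiag _ he]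
    rw [← h3]
    have hrange : ∀ d ∈ imageEdges H g, ∀ x ∈ d, ∃ w, g w = x := by
      intro d hd x hx
      obtain ⟨c, -, rfl⟩ := mem_image.1 hd
      obtain ⟨w, -, hw⟩ := Sym2.mem_map.1 hx
      exact ⟨w, hw⟩
    refine le_trans (card_le_card (t := ({w | g w ∈ U} : Finset W).image g) ?_) card_image_le
    intro x hx
    have hxU : x ∈ U := by
      rcases mem_insert.1 hx with rfl | h
      · exact mem_union_right _ (by simpa using hzf)
      · exact mem_union_left _ h
    have : ∃ w, g w = x := by
      rcases mem_insert.1 hx with rfl | h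
      · exact hrange d hd x hzd
      · exact hrange e heE x (by simpa using h)
    obtain ⟨w, rfl⟩ := this
    exact mem_image_of_mem _ (by simpa using hxU)
  refine (card_le_card hsub).trans (card_image_le.trans ((card_maps_many_into 3 U).trans ?_))
  gcongr

end Counting

/-! ### Pairs of overlapping copies -/

section Overlap

variable {W V : Type*} [Fintype W] [DecidableEq V]

lemma imageEdges_inter {H : SimpleGraph W} [DecidableRel H.Adj] (f : W → V) (D : Finset (Sym2 V)) :
    imageEdges H f ∩ D = ({d ∈ H.edgeFinset | Sym2.map f d ∈ D}).image (Sym2.map f) := by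
  ext e
  simp only [imageEdges, mem_inter, mem_image, mem_filter]
  grind

variable [DecidableEq W]

/-- Up to a constant, the expected number of copies of `H` that extend a proper subgraph of a given
copy having at least two edges: a subgraph with edge set `A` leaves `v_H - v_A` vertices and
`e_H - e_A` edges free. -/
noncomputable def extensionSum (H : SimpleGraph W) [DecidableRel H.Adj] (n : ℕ) (p : ℝ) : ℝ :=
  ∑ A ∈ H.edgeFinset.ssubsets with 2 ≤ #A,
    (n : ℝ) ^ (Fintype.card W - #(incidentVerts A)) * p ^ (#H.edgeFinset - #A)

variable {H : SimpleGraph W} [DecidableRel H.Adj]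

lemma extensionSum_nonneg {n : ℕ} {p : ℝ} (hp : 0 ≤ p) : 0 ≤ extensionSum H n p :=
  sum_nonneg fun _ _ ↦ by positivity

lemma card_incidentVerts_le [Fintype V] (D : Finset (Sym2 V)) : #(incidentVerts D) ≤ 2 * #D := by
  have : incidentVerts D ⊆ D.biUnion Sym2.toFinset := by
    intro w hw
    simp only [incidentVerts, mem_filter, mem_univ, true_and] at hw
    obtain ⟨e, he, hw⟩ := hw
    exact mem_biUnion.2 ⟨e, he, by simpa using hw⟩
  refine (card_le_card this).trans ((card_biUnion_le_card_mul _ _ 2 fun e _ ↦ ?_).trans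
    (mul_comm _ _).le)
  rw [Sym2.card_toFinset]
  split_ifs <;> simp

variable [Fintype V]

variable (H) in
/-- A bound for the number of ways to place the vertices of a subgraph of `H` on the vertices of a
given set of at most `e_H + 1` pairs. -/
def placements : ℕ := (2 * (#H.edgeFinset + 1)) ^ Fintype.card W

lemma card_extensions_le {D : Finset (Sym2 V)} (hD : #D ≤ #H.edgeFinset + 1)
    (A : Finset (Sym2 W)) :
    #{f : W → V | ∀ d ∈ A, Sym2.map f d ∈ D} ≤
      placements H * Fintype.card V ^ (Fintype.card W - #(incidentVerts A)) := by
  have hsub : ({f : W → V | ∀ d ∈ A, Sym2.map f d ∈ D} : Finset (W → V)) ⊆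
      ({f : W → V | ∀ w ∈ incidentVerts A, f w ∈ incidentVerts D} : Finset (W → V)) := by
    intro f hf
    simp only [mem_filter, mem_univ, true_and, incidentVerts] at hf ⊢
    rintro w ⟨d, hd, hw⟩
    exact ⟨_, hf d hd, Sym2.mem_map.2 ⟨w, hw, rfl⟩⟩
  refine (card_le_card hsub).trans ?_
  rw [card_maps_into]
  refine Nat.mul_le_mul_right _ ?_
  calc #(incidentVerts D) ^ #(incidentVerts A)
      ≤ (2 * (#H.edgeFinset + 1)) ^ #(incidentVerts A) := by
        refine Nat.pow_le_pow_left ((card_incidentVerts_le D).trans ?_) _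
        omega
    _ ≤ placements H := Nat.pow_le_pow_right (by omega) (card_le_univ _)

/-- The copies that share at least two pairs with `D`, but are not contained in `D`. -/
lemma sum_copies_overlapping_le {p : ℝ} (hp : 0 ≤ p) {D : Finset (Sym2 V)}
    (hD : #D ≤ #H.edgeFinset + 1) :
    ∑ E ∈ copies V H with 2 ≤ #(E ∩ D) ∧ ¬ E ⊆ D, p ^ #(E \ D) ≤
      placements H * extensionSum H (Fintype.card V) p := by
  set F : Finset (W → V) := {f | Function.Injective f ∧ 2 ≤ #(imageEdges H f ∩ D) ∧
    ¬ imageEdges H f ⊆ D} with hF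
  set T : (W → V) → Finset (Sym2 W) := fun f ↦ {d ∈ H.edgeFinset | Sym2.map f d ∈ D} with hT
  have hsub : ({E ∈ copies V H | 2 ≤ #(E ∩ D) ∧ ¬ E ⊆ D} : Finset _) ⊆ F.image (imageEdges H) := by
    intro E hE
    obtain ⟨hE, h⟩ := mem_filter.1 hE
    obtain ⟨f, hf, rfl⟩ := mem_copies.1 hE
    exact mem_image_of_mem _ (mem_filter.2 ⟨mem_univ _, hf, h⟩)
  have hTc : ∀ f ∈ F, #(imageEdges H f ∩ D) = #(T f) := by
    intro f hf
    rw [imageEdges_inter, card_image_of_injective _ (Sym2.map.injective (mem_filter.1 hf).2.1)]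
  have hmaps : ∀ f ∈ F, T f ∈ ({A ∈ H.edgeFinset.ssubsets | 2 ≤ #A} : Finset _) := by
    intro f hf
    obtain ⟨hinj, h2, hnot⟩ := (mem_filter.1 hf).2
    rw [mem_filter, mem_ssubsets]
    refine ⟨(filter_subset _ _).ssubset_of_ne fun h ↦ hnot ?_, by rw [← hTc f hf]; exact h2⟩
    intro e he
    obtain ⟨d, hd, rfl⟩ := mem_image.1 he
    rw [← h] at hd
    exact (mem_filter.1 hd).2
  refine (sum_le_sum_of_subset_of_nonneg hsub fun _ _ _ ↦ by positivity).trans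
    ((sum_image_le_of_nonneg fun _ _ ↦ by positivity).trans ?_)
  -- The embeddings are sorted by the set `T f` of the edges of `H` that they map into `D`.
  rw [← sum_fiberwise_of_maps_to hmaps, extensionSum, mul_sum]
  refine sum_le_sum fun A hA ↦ ?_
  have hterm : ∀ f ∈ F.filter (fun f ↦ T f = A),
      p ^ #(imageEdges H f \ D) = p ^ (#H.edgeFinset - #A) := by
    intro f hf
    obtain ⟨hf, hfA⟩ := mem_filter.1 hf
    rw [← hfA, ← hTc f hf, ← card_imageEdges (H := H) (mem_filter.1 hf).2.1,
      ← card_sdiff_add_card_inter (imageEdges H f) D, Nat.add_sub_cancel]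
  rw [sum_congr rfl hterm, sum_const, nsmul_eq_mul, ← mul_assoc]
  refine mul_le_mul_of_nonneg_right ?_ (by positivity)
  have hc : #(F.filter fun f ↦ T f = A) ≤ #{f : W → V | ∀ d ∈ A, Sym2.map f d ∈ D} := by
    refine card_le_card fun f hf ↦ ?_
    obtain ⟨-, rfl⟩ := mem_filter.1 hf
    exact mem_filter.2 ⟨mem_univ _, fun d hd ↦ (mem_filter.1 hd).2⟩
  exact_mod_cast hc.trans (card_extensions_le hD A)

/-- If a copy of `H` through `h` is contained in a copy through `g` together with the pair `h`, then
the latter copy passes near `h`, unless `g` and `h` form a copy of `H` themselves. The exception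
occurs for the path with three vertices. -/
lemma mem_copiesNear_of_subset (hbal : IsStrictlyTwoBalanced H) (hconn : H.Connected)
    {g h : Sym2 V} (hg : ¬ g.IsDiag) (hh : ¬ h.IsDiag) (hgh : g ≠ h) {E₁ E₂ : Finset (Sym2 V)}
    (h1 : E₁ ∈ copiesThrough H g) (h2 : E₂ ∈ copiesThrough H h)
    (hsub : E₂ ⊆ insert h E₁) (hno : ∀ E ∈ copiesThrough H g, ¬ E ⊆ {g, h}) :
    E₁ ∈ copiesNear H g h := by
  -- Otherwise some `f w ∈ h \ g` lies in no pair of `E₁`, so that `w` has degree one in `H`.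
  by_contra hnear
  have hfar : ∀ z ∈ h, z ∉ g → ∀ d ∈ E₁, z ∉ d := by
    intro z hzh hzg d hd hzd
    exact hnear (mem_copiesNear.2 ⟨h1, z, hzh, hzg, d, hd, hzd⟩)
  obtain ⟨h2, hhE⟩ := mem_copiesThrough.1 h2
  obtain ⟨f, hf, rfl⟩ := mem_copies.1 h2
  obtain ⟨d₀, hd₀, rfl⟩ := mem_image.1 hhE
  have hz : ∃ w ∈ d₀, f w ∉ g := by
    by_contra! hall
    have hs : (Sym2.map f d₀).toFinset ⊆ g.toFinset := by
      intro z hz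
      obtain ⟨w, hw, rfl⟩ := Sym2.mem_map.1 (Sym2.mem_toFinset.1 hz)
      exact Sym2.mem_toFinset.2 (hall w hw)
    have heq := eq_of_subset_of_card_le hs (by
      rw [Sym2.card_toFinset_of_not_isDiag _ hg, Sym2.card_toFinset_of_not_isDiag _ hh])
    exact hgh (Sym2.ext fun z ↦ by rw [← Sym2.mem_toFinset, ← heq, Sym2.mem_toFinset])
  obtain ⟨w, hw, hwg⟩ := hz
  have hmem : ∀ d ∈ H.edgeFinset, d ≠ d₀ → Sym2.map f d ∈ E₁ := by
    intro d hd hne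
    have := hsub (mem_image_of_mem _ hd)
    exact (mem_insert.1 this).resolve_left fun h ↦ hne (Sym2.map.injective hf h)
  have hpend : ∀ d ∈ H.edgeFinset, w ∈ d → d = d₀ := by
    intro d hd hwd
    by_contra hne
    exact hfar (f w) (Sym2.mem_map.2 ⟨w, hw, rfl⟩) hwg _ (hmem d hd hne)
      (Sym2.mem_map.2 ⟨w, hwd, rfl⟩)
  obtain ⟨hW, hE⟩ := card_of_pendant hbal hconn hd₀ hw hpend
  -- Now `H` is a path, and the second pair of `E₂` shares its middle vertex `f c` with `h`.
  obtain ⟨d₁, hd₁, hne⟩ := exists_mem_ne (by omega : 1 < #H.edgeFinset) d₀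
  have hedges : H.edgeFinset = {d₀, d₁} := by
    refine (eq_of_subset_of_card_le (insert_subset hd₀ (singleton_subset_iff.2 hd₁)) ?_).symm
    rw [hE, card_pair hne.symm]
  have hdiag : ∀ d ∈ H.edgeFinset, ¬ d.IsDiag := fun d hd ↦
    H.not_isDiag_of_mem_edgeSet (by simpa using hd)
  have hc : ∃ c ∈ d₀, c ∈ d₁ := by
    by_contra! hall
    have hdisj : Disjoint d₀.toFinset d₁.toFinset := disjoint_left.2 fun c hc hc' ↦
      hall c (by simpa using hc) (by simpa using hc')
    have := card_le_univ (d₀.toFinset ∪ d₁.toFinset)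
    rw [card_union_of_disjoint hdisj, Sym2.card_toFinset_of_not_isDiag _ (hdiag _ hd₀),
      Sym2.card_toFinset_of_not_isDiag _ (hdiag _ hd₁)] at this
    omega
  obtain ⟨c, hc0, hc1⟩ := hc
  obtain ⟨a, rfl⟩ := Sym2.mem_iff_exists.1 hc0
  obtain ⟨b, rfl⟩ := Sym2.mem_iff_exists.1 hc1
  have hca : c ≠ a := by simpa using hdiag _ hd₀
  have hcb : c ≠ b := by simpa using hdiag _ hd₁
  have hab : a ≠ b := fun h ↦ hne (by rw [h])
  have hcg : f c ∈ g := by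
    by_contra hcg
    exact hfar (f c) (by simp) hcg _ (hmem _ hd₁ hne) (by simp)
  obtain ⟨y, rfl⟩ := Sym2.mem_iff_exists.1 hcg
  have hcy : f c ≠ y := by simpa using hg
  have hay : y ≠ f a := fun h ↦ hgh (by simp [h])
  have hall : ∀ u, u = a ∨ u = b ∨ u = c := by
    have h3 : #({a, b, c} : Finset W) = 3 := by
      rw [card_insert_of_notMem (by simp [hab, hca.symm]), card_pair hcb.symm]
    have huniv : ({a, b, c} : Finset W) = univ := by
      rw [← card_eq_iff_eq_univ, h3, hW]
    intro u
    have := mem_univ u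
    rw [← huniv] at this
    simpa using this
  have hfca : f c ≠ f a := fun h ↦ hca (hf h)
  -- As `f c` also lies in `g`, the pairs `g` and `h` are adjacent and form a path.
  set k : W → V := fun u ↦ if u = a then f a else if u = c then f c else y with hk
  have hka : k a = f a := by simp [hk]
  have hkc : k c = f c := by simp [hk, hca]
  have hkb : k b = y := by simp [hk, hab.symm, hcb.symm]
  have hkinj : Function.Injective k := by
    intro u u' h
    rcases hall u with rfl | rfl | rfl <;> rcases hall u' with rfl | rfl | rfl <;>
      grind
  have himg : imageEdges H k = {s(f c, y), s(f c, f a)} := by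
    rw [imageEdges, hedges, image_insert, image_singleton, Sym2.map_mk, Sym2.map_mk, hka, hkb, hkc,
      pair_comm]
  refine hno (imageEdges H k) (mem_copiesThrough.2 ⟨mem_copies.2 ⟨k, hkinj, rfl⟩, ?_⟩) ?_
  · rw [himg]; simp
  · rw [himg, Sym2.map_mk]

end Overlap

/-! ### Janson's inequality for the copies through one or two given pairs -/

section Rooted

/-- A bound for the number of copies of `H` near another pair. -/
def nearBound (W V : Type*) [Fintype W] [Fintype V] : ℕ :=
  2 ^ Fintype.card W * (4 ^ 3 * Fintype.card V ^ (Fintype.card W - 3))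

lemma nearBound_eq (W V : Type*) [Fintype W] [Fintype V] : (nearBound W V : ℝ) =
    2 ^ (Fintype.card W + 6) * (Fintype.card V : ℝ) ^ (Fintype.card W - 3) := by
  rw [nearBound]
  push_cast
  ring

variable {W V : Type*} [Fintype W] [DecidableEq W] [Fintype V] [DecidableEq V]

/-- The copies of `H` containing exactly one pair of `R`, together with that pair. -/
def rooted (H : SimpleGraph W) [DecidableRel H.Adj] (R : Finset (Sym2 V)) :
    Finset (Sym2 V × Finset (Sym2 V)) :=
  {i ∈ R ×ˢ copies V H | i.2 ∩ R = {i.1}}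

/-- A rooted copy of `H` without its root. -/
def unroot (i : Sym2 V × Finset (Sym2 V)) : Finset (Sym2 V) := i.2.erase i.1

variable {H : SimpleGraph W} [DecidableRel H.Adj] {R : Finset (Sym2 V)}

lemma mem_rooted {i : Sym2 V × Finset (Sym2 V)} :
    i ∈ rooted H R ↔ i.1 ∈ R ∧ i.2 ∈ copies V H ∧ i.2 ∩ R = {i.1} := by
  simp [rooted, and_assoc]

lemma root_mem {i : Sym2 V × Finset (Sym2 V)} (hi : i ∈ rooted H R) : i.1 ∈ i.2 := by
  have : i.1 ∈ i.2 ∩ R := by rw [(mem_rooted.1 hi).2.2]; exact mem_singleton_self _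
  exact (mem_inter.1 this).1

lemma eq_root {i : Sym2 V × Finset (Sym2 V)} (hi : i ∈ rooted H R) {g : Sym2 V} (hg : g ∈ R)
    (hgi : g ∈ i.2) : g = i.1 := by
  have : g ∈ i.2 ∩ R := mem_inter.2 ⟨hgi, hg⟩
  rwa [(mem_rooted.1 hi).2.2, mem_singleton] at this

lemma card_unroot {i : Sym2 V × Finset (Sym2 V)} (hi : i ∈ rooted H R) :
    #(unroot i) = #H.edgeFinset - 1 := by
  rw [unroot, card_erase_of_mem (root_mem hi), card_of_mem_copies (mem_rooted.1 hi).2.1]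

lemma disjoint_unroot {i : Sym2 V × Finset (Sym2 V)} (hi : i ∈ rooted H R) :
    Disjoint R (unroot i) := by
  refine disjoint_left.2 fun g hg hgi ↦ ?_
  exact (mem_erase.1 hgi).1 (eq_root hi hg (mem_erase.1 hgi).2)

lemma card_unroot_union {i j : Sym2 V × Finset (Sym2 V)} (hi : i ∈ rooted H R)
    (hj : j ∈ rooted H R) :
    #(unroot i ∪ unroot j) = (#H.edgeFinset - 1) + #(j.2 \ insert j.1 i.2) := by
  have : unroot j \ unroot i = j.2 \ insert j.1 i.2 := by
    ext x
    have h := @eq_root _ _ _ _ _ _ _ _ R j hj i.1 (mem_rooted.1 hi).1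
    simp only [unroot, Finset.mem_sdiff, mem_erase, mem_insert]
    grind
  rw [← this, ← union_sdiff_self_eq_union, card_union_of_disjoint disjoint_sdiff, card_unroot hi]

lemma card_rooted_le (R : Finset (Sym2 V)) : #(rooted H R) ≤ ∑ g ∈ R, #(copiesThrough H g) := by
  have hsub : rooted H R ⊆ R.biUnion fun g ↦ (copiesThrough H g).image (Prod.mk g) := by
    intro i hi
    have h := mem_rooted.1 hi
    exact mem_biUnion.2 ⟨i.1, h.1, mem_image.2 ⟨i.2, mem_copiesThrough.2 ⟨h.2.1, root_mem hi⟩, rfl⟩⟩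
  exact (card_le_card hsub).trans (card_biUnion_le.trans (sum_le_sum fun g _ ↦ card_image_le))

/-- The rooted copies that pass near another pair of `R`. -/
def nearRooted (H : SimpleGraph W) [DecidableRel H.Adj] (R : Finset (Sym2 V)) :
    Finset (Sym2 V × Finset (Sym2 V)) :=
  {i ∈ rooted H R | ∃ h ∈ R, i.2 ∈ copiesNear H i.1 h}

lemma card_nearRooted_le (hR : ∀ g ∈ R, ¬ g.IsDiag) :
    #(nearRooted H R) ≤ #R * #R * nearBound W V := by
  have hsub : nearRooted H R ⊆
      (R ×ˢ R).biUnion fun r ↦ (copiesNear H r.1 r.2).image (Prod.mk r.1) := by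
    intro i hi
    obtain ⟨hi, h, hh, hn⟩ := mem_filter.1 hi
    exact mem_biUnion.2 ⟨(i.1, h), mem_product.2 ⟨(mem_rooted.1 hi).1, hh⟩,
      mem_image.2 ⟨i.2, hn, rfl⟩⟩
  refine (card_le_card hsub).trans ((card_biUnion_le_card_mul _ _ _ fun r hr ↦
    card_image_le.trans (card_copiesNear_le (hR _ (mem_product.1 hr).1))).trans ?_)
  rw [card_product, nearBound]

/-- The contribution of one rooted copy to the error term in Janson's inequality. -/
lemma sum_overlap_le (hbal : IsStrictlyTwoBalanced H) (hconn : H.Connected)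
    (hR : ∀ g ∈ R, ¬ g.IsDiag)
    (hno : ∀ g ∈ R, ∀ h ∈ R, g ≠ h → ∀ E ∈ copiesThrough H g, ¬ E ⊆ {g, h}) {p : ℝ} (hp : 0 ≤ p)
    {i : Sym2 V × Finset (Sym2 V)} (hi : i ∈ rooted H R) :
    ∑ j ∈ rooted H R with j ≠ i ∧ ¬ Disjoint (unroot i) (unroot j), p ^ #(unroot i ∪ unroot j) ≤
      p ^ (#H.edgeFinset - 1) * (#R * (placements H * extensionSum H (Fintype.card V) p) +
        if i ∈ nearRooted H R then (#R * 2 ^ (#H.edgeFinset + 1) : ℝ) else 0) := by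
  set J := (rooted H R).filter fun j ↦ j ≠ i ∧ ¬ Disjoint (unroot i) (unroot j) with hJ
  -- Given the first copy, a second copy rooted at `h` has its free pairs outside `D h`, and at
  -- least two pairs in `D h`: the root and a common pair.
  set D : Sym2 V → Finset (Sym2 V) := fun h ↦ insert h i.2 with hD
  have hDc : ∀ h, #(D h) ≤ #H.edgeFinset + 1 := by
    intro h
    refine (card_insert_le _ _).trans ?_
    rw [card_of_mem_copies (mem_rooted.1 hi).2.1]
  have hJr : ∀ j ∈ J, j ∈ rooted H R := fun j hj ↦ (mem_filter.1 hj).1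
  rw [sum_congr rfl fun j hj ↦ by rw [card_unroot_union hi (hJr j hj), pow_add], ← mul_sum]
  refine mul_le_mul_of_nonneg_left ?_ (by positivity)
  rw [← sum_filter_add_sum_filter_not J fun j ↦ ¬ j.2 ⊆ D j.1]
  refine add_le_add ?_ ?_
  · have hsub : (J.filter fun j ↦ ¬ j.2 ⊆ D j.1) ⊆
        (R ×ˢ copies V H).filter fun j ↦ 2 ≤ #(j.2 ∩ D j.1) ∧ ¬ j.2 ⊆ D j.1 := by
      intro j hj
      obtain ⟨hj, hnot⟩ := mem_filter.1 hj
      obtain ⟨hj, -, hnd⟩ := mem_filter.1 hj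
      have hm := mem_rooted.1 hj
      refine mem_filter.2 ⟨mem_product.2 ⟨hm.1, hm.2.1⟩, ?_, hnot⟩
      obtain ⟨x, hxi, hxj⟩ := not_disjoint_iff.1 hnd
      obtain ⟨hx1, hx2⟩ := mem_erase.1 hxj
      refine one_lt_card.2 ⟨j.1, mem_inter.2 ⟨root_mem hj, mem_insert_self _ _⟩, x, mem_inter.2
        ⟨hx2, mem_insert_of_mem (mem_erase.1 hxi).2⟩, hx1.symm⟩
    refine (sum_le_sum_of_subset_of_nonneg hsub fun _ _ _ ↦ by positivity).trans ?_
    have hprod : ∑ j ∈ (R ×ˢ copies V H).filter fun j ↦ 2 ≤ #(j.2 ∩ D j.1) ∧ ¬ j.2 ⊆ D j.1,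
          p ^ #(j.2 \ D j.1) =
        ∑ h ∈ R, ∑ E ∈ copies V H with 2 ≤ #(E ∩ D h) ∧ ¬ E ⊆ D h, p ^ #(E \ D h) := by
      rw [sum_filter, sum_product]
      exact sum_congr rfl fun h _ ↦ (sum_filter _ _).symm
    rw [← nsmul_eq_mul]
    exact hprod.trans_le (sum_le_card_nsmul _ _ _ fun h _ ↦ sum_copies_overlapping_le hp (hDc h))
  · have hnear : ∀ j ∈ J.filter fun j ↦ ¬ ¬ j.2 ⊆ D j.1, i ∈ nearRooted H R := by
      intro j hj
      obtain ⟨hj, hsub⟩ := mem_filter.1 hj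
      rw [not_not] at hsub
      obtain ⟨hj, hne, -⟩ := mem_filter.1 hj
      have hmi := mem_rooted.1 hi
      have hmj := mem_rooted.1 hj
      have hroots : i.1 ≠ j.1 := by
        intro h
        have hDi : D j.1 = i.2 := by
          rw [hD, ← h]
          exact insert_eq_of_mem (root_mem hi)
        rw [hDi] at hsub
        refine hne (Prod.ext h.symm (eq_of_subset_of_card_le hsub ?_))
        rw [card_of_mem_copies hmi.2.1, card_of_mem_copies hmj.2.1]
      exact mem_filter.2 ⟨hi, j.1, hmj.1, mem_copiesNear_of_subset hbal hconn (hR _ hmi.1)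
        (hR _ hmj.1) hroots (mem_copiesThrough.2 ⟨hmi.2.1, root_mem hi⟩)
        (mem_copiesThrough.2 ⟨hmj.2.1, root_mem hj⟩) hsub (hno _ hmi.1 _ hmj.1 hroots)⟩
    have hone : ∀ j ∈ J.filter fun j ↦ ¬ ¬ j.2 ⊆ D j.1, p ^ #(j.2 \ insert j.1 i.2) = 1 := by
      intro j hj
      have hsub := (mem_filter.1 hj).2
      rw [not_not] at hsub
      rw [sdiff_eq_empty_iff_subset.2 hsub, card_empty, pow_zero]
    rw [sum_congr rfl hone, sum_const, nsmul_eq_mul, mul_one]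
    split_ifs with h
    · have hsub : (J.filter fun j ↦ ¬ ¬ j.2 ⊆ D j.1) ⊆
          R.biUnion fun h ↦ (D h).powerset.image (Prod.mk h) := by
        intro j hj
        obtain ⟨hj, hsub⟩ := mem_filter.1 hj
        rw [not_not] at hsub
        exact mem_biUnion.2 ⟨j.1, (mem_rooted.1 (hJr j hj)).1,
          mem_image.2 ⟨j.2, mem_powerset.2 hsub, rfl⟩⟩
      have hc := (card_le_card hsub).trans (card_biUnion_le_card_mul _ _ (2 ^ (#H.edgeFinset + 1))
        fun h _ ↦ card_image_le.trans (by
          rw [card_powerset]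
          exact Nat.pow_le_pow_right (by norm_num) (hDc h)))
      exact_mod_cast hc
    · rw [filter_eq_empty_iff.2 fun j hj hj' ↦ h (hnear j (mem_filter.2 ⟨hj, hj'⟩))]
      simp

/-- The error term in Janson's inequality for the rooted copies. -/
lemma sum_sum_overlap_le (hbal : IsStrictlyTwoBalanced H) (hconn : H.Connected)
    (hR : ∀ g ∈ R, ¬ g.IsDiag) (hRc : #R ≤ 2)
    (hno : ∀ g ∈ R, ∀ h ∈ R, g ≠ h → ∀ E ∈ copiesThrough H g, ¬ E ⊆ {g, h}) {p : ℝ}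
    (hp : 0 ≤ p) :
    ∑ i ∈ rooted H R, ∑ j ∈ rooted H R with j ≠ i ∧ ¬ Disjoint (unroot i) (unroot j),
        p ^ #(unroot i ∪ unroot j) ≤
      p ^ (#H.edgeFinset - 1) *
        (4 * (rho H * (Fintype.card V : ℝ) ^ (Fintype.card W - 2)) *
          (placements H * extensionSum H (Fintype.card V) p) +
        8 * 2 ^ (#H.edgeFinset + 1) * nearBound W V) := by
  refine (sum_le_sum fun i hi ↦ sum_overlap_le hbal hconn hR hno hp hi).trans ?_
  rw [← mul_sum]
  refine mul_le_mul_of_nonneg_left ?_ (by positivity)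
  rw [sum_add_distrib, sum_const, nsmul_eq_mul]
  have hR2 : (#R : ℝ) ≤ 2 := by exact_mod_cast hRc
  have hext : 0 ≤ placements H * extensionSum H (Fintype.card V) p :=
    mul_nonneg (Nat.cast_nonneg _) (extensionSum_nonneg hp)
  have hrho : 0 ≤ rho H * (Fintype.card V : ℝ) ^ (Fintype.card W - 2) := by
    rw [rho_eq]
    positivity
  refine add_le_add ?_ ?_
  · have h1 : (#(rooted H R) : ℝ) ≤
        2 * (rho H * (Fintype.card V : ℝ) ^ (Fintype.card W - 2)) := by
      calc (#(rooted H R) : ℝ) ≤ ∑ g ∈ R, (#(copiesThrough H g) : ℝ) := by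
            exact_mod_cast card_rooted_le R
        _ ≤ #R • (rho H * (Fintype.card V : ℝ) ^ (Fintype.card W - 2)) :=
            sum_le_card_nsmul _ _ _ fun g hg ↦ card_copiesThrough_le hbal hconn (hR g hg)
        _ ≤ _ := by
            rw [nsmul_eq_mul]
            exact mul_le_mul_of_nonneg_right hR2 hrho
    calc (#(rooted H R) : ℝ) * (#R * (placements H * extensionSum H (Fintype.card V) p))
        ≤ (2 * (rho H * (Fintype.card V : ℝ) ^ (Fintype.card W - 2))) *
          (2 * (placements H * extensionSum H (Fintype.card V) p)) := by gcongr
      _ = _ := by ring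
  · rw [← sum_filter, sum_const, nsmul_eq_mul]
    have h1 : (#((rooted H R).filter fun i ↦ i ∈ nearRooted H R) : ℝ) ≤
        2 * 2 * nearBound W V := by
      have h2 : #((rooted H R).filter fun i ↦ i ∈ nearRooted H R) ≤
          2 * 2 * nearBound W V := by
        refine (card_le_card fun i hi ↦ (mem_filter.1 hi).2).trans
          ((card_nearRooted_le hR).trans ?_)
        gcongr
      exact_mod_cast h2
    calc _ ≤ (2 * 2 * nearBound W V : ℝ) * (2 * 2 ^ (#H.edgeFinset + 1)) := by gcongr
      _ = _ := by ring

/-- A bound for the relative error in approximating the probabilities below by those for independent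
copies. The first summand comes from overlaps in proper subgraphs, the second one from copies near
another pair, and the third one from `log (1 - x) = -x + O(x ^ 2)` for `x = p ^ (e_H - 1)`. -/
noncomputable def errorTerm (H : SimpleGraph W) [DecidableRel H.Adj] (n : ℕ) (p : ℝ) : ℝ :=
  4 * rho H * placements H *
      ((n : ℝ) ^ (Fintype.card W - 2) * p ^ (#H.edgeFinset - 1) * extensionSum H n p) +
    2 ^ (#H.edgeFinset + Fintype.card W + 11) *
      ((n : ℝ) ^ (Fintype.card W - 3) * p ^ (#H.edgeFinset - 1)) +
    4 * rho H * ((n : ℝ) ^ (Fintype.card W - 2) * p ^ (2 * (#H.edgeFinset - 1)))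

lemma prob_avoid_rooted_le (hbal : IsStrictlyTwoBalanced H) (hconn : H.Connected)
    (hR : ∀ g ∈ R, ¬ g.IsDiag) (hRc : #R ≤ 2)
    (hno : ∀ g ∈ R, ∀ h ∈ R, g ≠ h → ∀ E ∈ copiesThrough H g, ¬ E ⊆ {g, h}) {p : ℝ}
    (h0 : 0 ≤ p) (h1 : p ≤ 1) :
    prob p (avoid (rooted H R) unroot) ≤ Real.exp (-#(rooted H R) * p ^ (#H.edgeFinset - 1) +
      p ^ (#H.edgeFinset - 1) *
        (4 * (rho H * (Fintype.card V : ℝ) ^ (Fintype.card W - 2)) *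
          (placements H * extensionSum H (Fintype.card V) p) +
        8 * 2 ^ (#H.edgeFinset + 1) * nearBound W V)) := by
  refine (prob_avoid_le h0 h1 _ _).trans (Real.exp_le_exp.2 (add_le_add ?_
    (sum_sum_overlap_le hbal hconn hR hRc hno h0)))
  rw [sum_congr rfl fun i hi ↦ by rw [card_unroot hi], sum_const, nsmul_eq_mul, neg_mul]

lemma badEdge_eq (e : Sym2 V) :
    badEdge H e = {S | {e} ⊆ S} ∩ avoid (rooted H {e}) unroot := by
  ext S
  simp only [badEdge, avoid, Set.mem_ofPred_eq, Set.mem_inter_iff, singleton_subset_iff]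
  refine and_congr_right fun he ↦ ⟨fun h i hi hiS ↦ ?_, fun h E hE hES ↦ ?_⟩
  · have hm := mem_rooted.1 hi
    have hi1 : i.1 = e := by simpa using hm.1
    refine h i.2 (mem_copiesThrough.2 ⟨hm.2.1, hi1 ▸ root_mem hi⟩) fun x hx ↦ ?_
    by_cases hxe : x = e
    · rwa [hxe]
    · exact hiS (mem_erase.2 ⟨hi1.symm ▸ hxe, hx⟩)
  · obtain ⟨hE, heE⟩ := mem_copiesThrough.1 hE
    refine h (e, E) (mem_rooted.2 ⟨by simp, hE, ?_⟩) ((erase_subset _ _).trans hES)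
    exact inter_singleton_of_mem heE

lemma prob_badEdge (p : ℝ) (e : Sym2 V) :
    prob p (badEdge H e) = p * prob p (avoid (rooted H {e}) unroot) := by
  rw [badEdge_eq, prob_subset_inter _ _ (insensitive_avoid fun i hi ↦ disjoint_unroot hi)]
  simp

lemma card_rooted_singleton (e : Sym2 V) : #(rooted H {e}) = #(copiesThrough H e) := by
  have : rooted H {e} = (copiesThrough H e).image (Prod.mk e) := by
    ext ⟨g, E⟩
    simp only [mem_rooted, mem_singleton, mem_image, mem_copiesThrough, Prod.mk.injEq]
    constructor
    · rintro ⟨rfl, hE, h⟩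
      refine ⟨E, ⟨hE, ?_⟩, rfl, rfl⟩
      by_contra hg
      rw [inter_singleton_of_notMem hg] at h
      exact (singleton_ne_empty _ h.symm).elim
    · rintro ⟨E, ⟨hE, he⟩, rfl, rfl⟩
      exact ⟨rfl, hE, inter_singleton_of_mem he⟩
  rw [this, card_image_of_injective _ fun _ _ h ↦ (Prod.mk.inj h).2]

/-- Almost all copies through `e` or `f` contain only one of them. -/
lemma card_rooted_pair {e f : Sym2 V} (hef : e ≠ f) (he : ¬ e.IsDiag) (hf : ¬ f.IsDiag) :
    #(copiesThrough H e) + #(copiesThrough H f) ≤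
      #(rooted H {e, f}) + 2 * nearBound W V := by
  have hz : ∀ {a b : Sym2 V}, a ≠ b → ¬ a.IsDiag → ¬ b.IsDiag → ∃ z ∈ b, z ∉ a := by
    intro a b hab ha hb
    by_contra! hall
    have hs : b.toFinset ⊆ a.toFinset := fun z hz ↦
      Sym2.mem_toFinset.2 (hall z (Sym2.mem_toFinset.1 hz))
    have heq := eq_of_subset_of_card_le hs (by
      rw [Sym2.card_toFinset_of_not_isDiag _ ha, Sym2.card_toFinset_of_not_isDiag _ hb])
    exact hab (Sym2.ext fun z ↦ by rw [← Sym2.mem_toFinset, ← heq, Sym2.mem_toFinset])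
  have hsub : ∀ {a b : Sym2 V}, a ≠ b → ¬ a.IsDiag → ¬ b.IsDiag →
      copiesThrough H a ⊆ {E ∈ copiesThrough H a | b ∉ E} ∪ copiesNear H a b := by
    intro a b hab ha hb E hE
    by_cases hbE : b ∈ E
    · obtain ⟨z, hzb, hza⟩ := hz hab ha hb
      exact mem_union_right _ (mem_copiesNear.2 ⟨hE, z, hzb, hza, b, hbE, hzb⟩)
    · exact mem_union_left _ (mem_filter.2 ⟨hE, hbE⟩)
  have hle : ∀ {a b : Sym2 V}, a ≠ b → ¬ a.IsDiag → ¬ b.IsDiag →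
      #(copiesThrough H a) ≤ #{E ∈ copiesThrough H a | b ∉ E} + nearBound W V := by
    intro a b hab ha hb
    refine (card_le_card (hsub hab ha hb)).trans ((card_union_le _ _).trans ?_)
    exact Nat.add_le_add_left (card_copiesNear_le ha) _
  have hroot : #{E ∈ copiesThrough H e | f ∉ E} + #{E ∈ copiesThrough H f | e ∉ E} ≤
      #(rooted H {e, f}) := by
    rw [← card_image_of_injective {E ∈ copiesThrough H e | f ∉ E} (Prod.mk_right_injective e),
      ← card_image_of_injective {E ∈ copiesThrough H f | e ∉ E} (Prod.mk_right_injective f),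
      ← card_union_of_disjoint]
    · refine card_le_card fun i hi ↦ ?_
      rcases mem_union.1 hi with hi | hi <;> obtain ⟨E, hE, rfl⟩ := mem_image.1 hi <;>
        obtain ⟨hE, hn⟩ := mem_filter.1 hE <;> obtain ⟨hE, hm⟩ := mem_copiesThrough.1 hE
      · refine mem_rooted.2 ⟨by simp, hE, ?_⟩
        ext x
        simp only [mem_inter, mem_insert, mem_singleton]
        grind
      · refine mem_rooted.2 ⟨by simp, hE, ?_⟩
        ext x
        simp only [mem_inter, mem_insert, mem_singleton]
        grind
    · refine disjoint_left.2 fun i hi hi' ↦ ?_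
      obtain ⟨E, -, rfl⟩ := mem_image.1 hi
      obtain ⟨E', -, h⟩ := mem_image.1 hi'
      exact hef (congrArg Prod.fst h).symm
  have h1 := hle hef he hf
  have h2 := hle hef.symm hf he
  omega

lemma prob_avoid_rooted_singleton_le (hbal : IsStrictlyTwoBalanced H) (hconn : H.Connected)
    {e : Sym2 V} (he : ¬ e.IsDiag) {p : ℝ} (h0 : 0 ≤ p) (h1 : p ≤ 1) :
    prob p (avoid (rooted H {e}) unroot) ≤
      Real.exp (-#(copiesThrough H e) * p ^ (#H.edgeFinset - 1) +
        errorTerm H (Fintype.card V) p) := by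
  refine (prob_avoid_rooted_le (R := {e}) hbal hconn (by simpa using he) (by simp) ?_ h0
    h1).trans ?_
  · intro g hg h hh hgh
    exact (hgh ((mem_singleton.1 hg).trans (mem_singleton.1 hh).symm)).elim
  rw [card_rooted_singleton, errorTerm, nearBound_eq]
  refine Real.exp_le_exp.2 (add_le_add le_rfl ?_)
  have hrho : 0 ≤ rho H := by rw [rho_eq]; positivity
  set N := (Fintype.card V : ℝ)
  set q := p ^ (#H.edgeFinset - 1) with hq
  have hq0 : 0 ≤ q := by positivity
  have h2 : 0 ≤ 4 * rho H * (N ^ (Fintype.card W - 2) * p ^ (2 * (#H.edgeFinset - 1))) := by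
    positivity
  have h3 : 0 ≤ N ^ (Fintype.card W - 3) * q := by positivity
  have h4 : (8 * 2 ^ (#H.edgeFinset + 1) * 2 ^ (Fintype.card W + 6) : ℝ) ≤
      2 ^ (#H.edgeFinset + Fintype.card W + 11) := by
    have : (8 * 2 ^ (#H.edgeFinset + 1) * 2 ^ (Fintype.card W + 6) : ℝ) =
        2 ^ (#H.edgeFinset + Fintype.card W + 10) := by ring
    rw [this]
    exact pow_le_pow_right₀ (by norm_num) (by omega)
  nlinarith [mul_le_mul_of_nonneg_right h4 h3]

lemma exp_neg_le_one_sub {x : ℝ} (h : x ≤ 1 / 2) :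
    Real.exp (-(x + 2 * x ^ 2)) ≤ 1 - x := by
  have h1 : 1 ≤ (1 - x) * Real.exp (x + 2 * x ^ 2) := by
    have h2 := Real.add_one_le_exp (x + 2 * x ^ 2)
    have h3 : 1 ≤ (1 - x) * (x + 2 * x ^ 2 + 1) := by nlinarith [sq_nonneg x]
    exact h3.trans (mul_le_mul_of_nonneg_left h2 (by linarith))
  rw [Real.exp_neg, inv_le_iff_one_le_mul₀ (Real.exp_pos _)]
  exact h1

lemma le_prob_badEdge (e : Sym2 V) {p : ℝ} (h0 : 0 ≤ p) (h1 : p ≤ 1)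
    (hsmall : p ^ (#H.edgeFinset - 1) ≤ 1 / 2) :
    p * Real.exp (-(#(copiesThrough H e) *
      (p ^ (#H.edgeFinset - 1) + 2 * (p ^ (#H.edgeFinset - 1)) ^ 2))) ≤ prob p (badEdge H e) := by
  rw [prob_badEdge]
  refine mul_le_mul_of_nonneg_left ?_ h0
  refine le_trans ?_ (prod_le_prob_avoid h0 h1 _ _)
  rw [prod_congr rfl fun i hi ↦ by rw [card_unroot hi], prod_const, card_rooted_singleton,
    ← mul_neg, mul_comm, Real.exp_mul, Real.rpow_natCast]
  exact pow_le_pow_left₀ (Real.exp_pos _).le (exp_neg_le_one_sub hsmall) _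

/-- The events that two given pairs are edges in no copy of `H` are almost independent. -/
lemma prob_badEdge_inter_le (hbal : IsStrictlyTwoBalanced H) (hconn : H.Connected)
    {e f : Sym2 V} (hef : e ≠ f) (he : ¬ e.IsDiag) (hf : ¬ f.IsDiag) {p : ℝ} (h0 : 0 ≤ p)
    (h1 : p ≤ 1) (hsmall : p ^ (#H.edgeFinset - 1) ≤ 1 / 2) :
    prob p (badEdge H e ∩ badEdge H f) ≤ Real.exp (errorTerm H (Fintype.card V) p) *
      (prob p (badEdge H e) * prob p (badEdge H f)) := by
  have hrhs : 0 ≤ Real.exp (errorTerm H (Fintype.card V) p) *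
      (prob p (badEdge H e) * prob p (badEdge H f)) :=
    mul_nonneg (Real.exp_pos _).le (mul_nonneg (prob_nonneg h0 h1 _) (prob_nonneg h0 h1 _))
  by_cases hno : ∀ g ∈ ({e, f} : Finset (Sym2 V)), ∀ h ∈ ({e, f} : Finset (Sym2 V)), g ≠ h →
      ∀ E ∈ copiesThrough H g, ¬ E ⊆ {g, h}
  swap
  -- If `e` and `f` form a copy of `H` themselves, they cannot both be edges in no copy.
  · have hempty : badEdge H e ∩ badEdge H f = ∅ := by
      push Not at hno
      obtain ⟨g, hg, h, hh, -, E, hE, hsub⟩ := hno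
      refine Set.eq_empty_of_forall_notMem fun S hS ↦ ?_
      have hS' : ∀ g ∈ ({e, f} : Finset (Sym2 V)), S ∈ badEdge H g := by
        intro g hg
        rcases mem_insert.1 hg with rfl | hg
        · exact hS.1
        · rw [mem_singleton.1 hg]; exact hS.2
      exact (hS' g hg).2 E hE
        (hsub.trans (insert_subset (hS' g hg).1 (singleton_subset_iff.2 (hS' h hh).1)))
    rwa [hempty, prob_empty]
  have hsub : badEdge H e ∩ badEdge H f ⊆
      {S | {e, f} ⊆ S} ∩ avoid (rooted H {e, f}) unroot := by
    rintro S ⟨⟨heS, hSe⟩, hfS, hSf⟩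
    have hefS : {e, f} ⊆ S := insert_subset heS (singleton_subset_iff.2 hfS)
    refine ⟨hefS, fun i hi hiS ↦ ?_⟩
    have hm := mem_rooted.1 hi
    have hiS' : i.2 ⊆ S := by
      rw [← insert_erase (root_mem hi)]
      exact insert_subset (hefS hm.1) hiS
    have := root_mem hi
    rcases mem_insert.1 hm.1 with h | h
    · exact hSe i.2 (mem_copiesThrough.2 ⟨hm.2.1, h ▸ this⟩) hiS'
    · rw [mem_singleton] at h
      exact hSf i.2 (mem_copiesThrough.2 ⟨hm.2.1, h ▸ this⟩) hiS'
  have hle := prob_mono h0 h1 hsub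
  rw [prob_subset_inter _ _ (insensitive_avoid fun i hi ↦ disjoint_unroot hi), card_pair hef] at hle
  have hjan :=
    prob_avoid_rooted_le (R := {e, f}) hbal hconn (by simp [he, hf]) card_le_two hno h0 h1
  refine hle.trans ((mul_le_mul_of_nonneg_left hjan (by positivity)).trans ?_)
  refine le_trans ?_ (mul_le_mul_of_nonneg_left (mul_le_mul (le_prob_badEdge e h0 h1 hsmall)
    (le_prob_badEdge f h0 h1 hsmall) (by positivity) (prob_nonneg h0 h1 _)) (Real.exp_pos _).le)
  rw [mul_mul_mul_comm p, ← pow_two p, ← Real.exp_add, mul_left_comm (Real.exp _), ← Real.exp_add]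
  refine mul_le_mul_of_nonneg_left (Real.exp_le_exp.2 ?_) (by positivity)
  have hc : (#(copiesThrough H e) + #(copiesThrough H f) : ℝ) ≤
      #(rooted H {e, f}) + 2 * nearBound W V := by
    have hc' := card_rooted_pair (H := H) hef he hf
    exact_mod_cast hc'
  have hce := card_copiesThrough_le hbal hconn he
  have hcf := card_copiesThrough_le hbal hconn hf
  rw [nearBound_eq] at hc ⊢
  rw [errorTerm, mul_comm 2 (#H.edgeFinset - 1), pow_mul p]
  set N := (Fintype.card V : ℝ)
  set q := p ^ (#H.edgeFinset - 1) with hq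
  have hq0 : 0 ≤ q := by positivity
  have h3 : 0 ≤ N ^ (Fintype.card W - 3) * q := by positivity
  have h4 : (8 * 2 ^ (#H.edgeFinset + 1) * 2 ^ (Fintype.card W + 6) +
      2 * 2 ^ (Fintype.card W + 6) : ℝ) ≤ 2 ^ (#H.edgeFinset + Fintype.card W + 11) := by
    have h5 : (1 : ℝ) ≤ 2 ^ #H.edgeFinset := one_le_pow₀ (by norm_num)
    have h6 : (0 : ℝ) < 2 ^ Fintype.card W := by positivity
    have : (2 ^ (#H.edgeFinset + Fintype.card W + 11) : ℝ) =
        2048 * (2 ^ #H.edgeFinset * 2 ^ Fintype.card W) := by ring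
    rw [this, pow_succ, pow_add _ _ 6]
    nlinarith
  have h7 := mul_le_mul_of_nonneg_right h4 h3
  have h8 := mul_le_mul_of_nonneg_right hc hq0
  have h9 := mul_le_mul_of_nonneg_right (add_le_add hce hcf) (sq_nonneg q)
  linarith

end Rooted

/-! ### Asymptotics at the threshold -/

section Asymptotic

variable {W : Type*} [Fintype W] {H : SimpleGraph W} [DecidableRel H.Adj]

lemma two_le_card_edgeFinset (hbal : IsStrictlyTwoBalanced H) (hconn : H.Connected) :
    2 ≤ #H.edgeFinset := by
  have h1 := three_le_card hbal
  have h2 := card_le_card_edgeFinset_add_one hconn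
  omega

lemma rho_pos (hbal : IsStrictlyTwoBalanced H) (hconn : H.Connected) : 0 < rho H := by
  have : Finite (H ≃g H) := Finite.of_injective _ DFunLike.coe_injective
  have hpos : (0 : ℝ) < Nat.card (H ≃g H) := by exact_mod_cast Nat.card_pos
  have hE : (0 : ℝ) < #H.edgeFinset := by
    exact_mod_cast (two_le_card_edgeFinset hbal hconn).trans_lt' two_pos
  rw [rho_eq]
  positivity

/-- `1 / m₂(H)` as a quotient of natural numbers. -/
lemma one_div_maxTwoDensity (hbal : IsStrictlyTwoBalanced H) (hconn : H.Connected) :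
    1 / maxTwoDensity H = ((Fintype.card W - 2 : ℕ) : ℝ) / ((#H.edgeFinset - 1 : ℕ) : ℝ) := by
  have h1 := three_le_card hbal
  have h2 := two_le_card_edgeFinset hbal hconn
  rw [maxTwoDensity_eq_div hbal, one_div_div, Nat.cast_sub (by omega), Nat.cast_sub (by omega)]
  norm_num

lemma one_le_exponent (hbal : IsStrictlyTwoBalanced H) (hconn : H.Connected) :
    1 ≤ 2 - 1 / maxTwoDensity H := by
  have h1 := three_le_card hbal
  have h2 := card_le_card_edgeFinset_add_one hconn
  have h3 : ((Fintype.card W - 2 : ℕ) : ℝ) ≤ ((#H.edgeFinset - 1 : ℕ) : ℝ) := by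
    exact_mod_cast (by omega : Fintype.card W - 2 ≤ #H.edgeFinset - 1)
  have h4 : (0 : ℝ) < ((#H.edgeFinset - 1 : ℕ) : ℝ) := by
    exact_mod_cast (by omega : 0 < #H.edgeFinset - 1)
  rw [one_div_maxTwoDensity hbal hconn]
  have := (div_le_one h4).2 h3
  linarith

lemma pStar_eq (hbal : IsStrictlyTwoBalanced H) (hconn : H.Connected) (n : ℕ) :
    pStar H n = (n : ℝ) ^ (-(1 / maxTwoDensity H)) *
      ((2 - 1 / maxTwoDensity H) * (rho H)⁻¹ * Real.log n) ^
        (1 / ((#H.edgeFinset - 1 : ℕ) : ℝ)) := by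
  have h2 := two_le_card_edgeFinset hbal hconn
  rw [pStar, ncard_edgeSet_eq, Nat.cast_sub (by omega), Nat.cast_one]

lemma coeff_pos (hbal : IsStrictlyTwoBalanced H) (hconn : H.Connected) :
    0 < (2 - 1 / maxTwoDensity H) * (rho H)⁻¹ :=
  mul_pos (by linarith [one_le_exponent hbal hconn]) (inv_pos.2 (rho_pos hbal hconn))

lemma pStar_nonneg (hbal : IsStrictlyTwoBalanced H) (hconn : H.Connected) (n : ℕ) :
    0 ≤ pStar H n := by
  rw [pStar_eq hbal hconn]
  have := (coeff_pos hbal hconn).le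
  have := Real.log_natCast_nonneg n
  positivity

lemma pStar_pos (hbal : IsStrictlyTwoBalanced H) (hconn : H.Connected) {n : ℕ} (hn : 2 ≤ n) :
    0 < pStar H n := by
  rw [pStar_eq hbal hconn]
  have h1 := coeff_pos hbal hconn
  have h2 : 0 < Real.log n := Real.log_pos (by exact_mod_cast hn)
  have h3 : (0 : ℝ) < n := by exact_mod_cast (by omega : 0 < n)
  positivity

/-- At the threshold, the number of copies of `H` through a given edge has mean asymptotic to
`(2 - 1 / m₂(H)) ln n`. -/
lemma rho_mul_pow_mul_pStar_pow (hbal : IsStrictlyTwoBalanced H) (hconn : H.Connected) {n : ℕ}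
    (hn : 1 ≤ n) :
    rho H * ((n : ℝ) ^ (Fintype.card W - 2) * pStar H n ^ (#H.edgeFinset - 1)) =
      (2 - 1 / maxTwoDensity H) * Real.log n := by
  have h2 := two_le_card_edgeFinset hbal hconn
  have hn0 : (0 : ℝ) < n := by exact_mod_cast hn
  have hE : ((#H.edgeFinset - 1 : ℕ) : ℝ) ≠ 0 := by
    exact_mod_cast (by omega : #H.edgeFinset - 1 ≠ 0)
  have hc := (coeff_pos hbal hconn).le
  have hl := Real.log_natCast_nonneg n
  have hrho := (rho_pos hbal hconn).ne'
  rw [pStar_eq hbal hconn, mul_pow, ← Real.rpow_natCast (_ ^ (1 / _)),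
    ← Real.rpow_mul (mul_nonneg hc hl), one_div_mul_cancel hE, Real.rpow_one,
    ← Real.rpow_natCast (_ ^ (-_)), ← Real.rpow_mul hn0.le, ← Real.rpow_natCast (n : ℝ),
    ← mul_assoc (_ ^ _), ← Real.rpow_add hn0]
  have : ((Fintype.card W - 2 : ℕ) : ℝ) +
      -(1 / maxTwoDensity H) * ((#H.edgeFinset - 1 : ℕ) : ℝ) = 0 := by
    rw [one_div_maxTwoDensity hbal hconn]
    field_simp
    ring
  rw [this, Real.rpow_zero]
  field_simp

lemma tendsto_rpow_mul_log_rpow {a : ℝ} (ha : a < 0) (b : ℝ) :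
    Tendsto (fun n : ℕ ↦ (n : ℝ) ^ a * Real.log n ^ b) atTop (𝓝 0) := by
  have h := ((isLittleO_log_rpow_rpow_atTop b (neg_pos.2 ha)).comp_tendsto
    tendsto_natCast_atTop_atTop).tendsto_div_nhds_zero
  refine h.congr fun n ↦ ?_
  simp only [Function.comp_apply]
  rw [Real.rpow_neg (Nat.cast_nonneg n), div_inv_eq_mul, mul_comm]

/-- The expected number of extensions by `j` free vertices and `k` free edges tends to zero at the
threshold if `k / j > m₂(H)`; the hypothesis is this inequality without denominators. -/
lemma tendsto_pow_mul_pStar_pow (hbal : IsStrictlyTwoBalanced H) (hconn : H.Connected) (C : ℝ)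
    {j k : ℕ} (hjk : j * (#H.edgeFinset - 1) < k * (Fintype.card W - 2)) :
    Tendsto (fun n : ℕ ↦ (n : ℝ) ^ j * (C * pStar H n) ^ k) atTop (𝓝 0) := by
  have h2 := two_le_card_edgeFinset hbal hconn
  have hE : (0 : ℝ) < ((#H.edgeFinset - 1 : ℕ) : ℝ) := by
    exact_mod_cast (by omega : 0 < #H.edgeFinset - 1)
  have hexp : (j : ℝ) + -(1 / maxTwoDensity H) * k < 0 := by
    rw [one_div_maxTwoDensity hbal hconn, neg_mul, ← sub_eq_add_neg, sub_neg, div_mul_eq_mul_div,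
      lt_div_iff₀ hE, mul_comm _ (k : ℝ)]
    exact_mod_cast hjk
  set c := (2 - 1 / maxTwoDensity H) * (rho H)⁻¹ with hc
  have hc0 : 0 ≤ c := (coeff_pos hbal hconn).le
  set b := 1 / ((#H.edgeFinset - 1 : ℕ) : ℝ) * k with hb
  have h := (tendsto_rpow_mul_log_rpow hexp b).const_mul (C ^ k * c ^ b)
  rw [mul_zero] at h
  refine h.congr' ?_
  filter_upwards [eventually_ge_atTop 1] with n hn
  have hn0 : (0 : ℝ) < n := by exact_mod_cast hn
  have hl := Real.log_natCast_nonneg n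
  rw [pStar_eq hbal hconn, mul_pow, mul_pow, ← Real.rpow_natCast (_ ^ (1 / _)),
    ← Real.rpow_mul (mul_nonneg hc0 hl), Real.mul_rpow hc0 hl, ← Real.rpow_natCast (_ ^ (-_)),
    ← Real.rpow_mul hn0.le, Real.rpow_add hn0, Real.rpow_natCast]
  ring

lemma tendsto_pStar (hbal : IsStrictlyTwoBalanced H) (hconn : H.Connected) (C : ℝ) :
    Tendsto (fun n : ℕ ↦ C * pStar H n) atTop (𝓝 0) := by
  have h1 := three_le_card hbal
  have := tendsto_pow_mul_pStar_pow hbal hconn C (j := 0) (k := 1) (by omega)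
  simpa using this

variable [DecidableEq W]

lemma extensionSum_mono {n : ℕ} {p q : ℝ} (h0 : 0 ≤ p) (hpq : p ≤ q) :
    extensionSum H n p ≤ extensionSum H n q :=
  sum_le_sum fun A _ ↦ by gcongr

lemma errorTerm_mono {n : ℕ} {p q : ℝ} (h0 : 0 ≤ p) (hpq : p ≤ q) :
    errorTerm H n p ≤ errorTerm H n q := by
  have h1 := extensionSum_mono (H := H) (n := n) h0 hpq
  have h2 := extensionSum_nonneg (H := H) (n := n) h0
  have h3 : 0 ≤ q := h0.trans hpq
  have hrho : 0 ≤ rho H := by rw [rho_eq]; positivity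
  unfold errorTerm
  gcongr

/-- Strict balancedness enters here: every proper subgraph with at least two edges has, at
the threshold, an expected number of extensions to `H` that tends to zero polynomially fast. -/
lemma tendsto_errorTerm (hbal : IsStrictlyTwoBalanced H) (hconn : H.Connected) (C : ℝ) :
    Tendsto (fun n : ℕ ↦ errorTerm H n (C * pStar H n)) atTop (𝓝 0) := by
  have hv := three_le_card hbal
  have he := two_le_card_edgeFinset hbal hconn
  have h1 : Tendsto (fun n : ℕ ↦ (n : ℝ) ^ (Fintype.card W - 2) *
      (C * pStar H n) ^ (#H.edgeFinset - 1) * extensionSum H n (C * pStar H n)) atTop (𝓝 0) := by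
    simp only [extensionSum, mul_sum]
    rw [← sum_const_zero (s := {A ∈ H.edgeFinset.ssubsets | 2 ≤ #A})]
    refine tendsto_finsetSum _ fun A hA ↦ ?_
    obtain ⟨hA, h2⟩ := mem_filter.1 hA
    rw [mem_ssubsets] at hA
    have hd := density_lt hbal hA h2
    have h3 := three_le_card_incidentVerts hA.1 h2
    have h4 := card_le_univ (incidentVerts A)
    have h5 := card_lt_card hA
    have key : (Fintype.card W - 2 + (Fintype.card W - #(incidentVerts A))) *
        (#H.edgeFinset - 1) < (#H.edgeFinset - 1 + (#H.edgeFinset - #A)) *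
          (Fintype.card W - 2) := by
      have : (((Fintype.card W - 2 + (Fintype.card W - #(incidentVerts A))) *
          (#H.edgeFinset - 1) : ℕ) : ℝ) < (((#H.edgeFinset - 1 + (#H.edgeFinset - #A)) *
          (Fintype.card W - 2) : ℕ) : ℝ) := by
        push_cast [Nat.cast_sub (show 2 ≤ Fintype.card W by omega), Nat.cast_sub h4,
          Nat.cast_sub (show 1 ≤ #H.edgeFinset by omega), Nat.cast_sub h5.le]
        nlinarith
      exact_mod_cast this
    refine (tendsto_pow_mul_pStar_pow hbal hconn C key).congr fun n ↦ ?_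
    rw [pow_add, pow_add]
    ring
  have h2 : Tendsto (fun n : ℕ ↦ (n : ℝ) ^ (Fintype.card W - 3) *
      (C * pStar H n) ^ (#H.edgeFinset - 1)) atTop (𝓝 0) := by
    refine tendsto_pow_mul_pStar_pow hbal hconn C ?_
    rw [mul_comm]
    exact Nat.mul_lt_mul_of_pos_left (by omega) (by omega)
  have h3 : Tendsto (fun n : ℕ ↦ (n : ℝ) ^ (Fintype.card W - 2) *
      (C * pStar H n) ^ (2 * (#H.edgeFinset - 1))) atTop (𝓝 0) := by
    refine tendsto_pow_mul_pStar_pow hbal hconn C ?_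
    rw [mul_comm]
    exact Nat.mul_lt_mul_of_pos_right (by omega) (by omega)
  have := ((h1.const_mul (4 * rho H * placements H)).add (h2.const_mul
    (2 ^ (#H.edgeFinset + Fintype.card W + 11)))).add (h3.const_mul (4 * rho H))
  simpa [errorTerm] using this

end Asymptotic

/-! ### The two sides of the threshold -/

section Threshold

variable {W : Type*} [Fintype W] [DecidableEq W] {H : SimpleGraph W} [DecidableRel H.Adj]

lemma card_edgeFinset_top_le (n : ℕ) :
    (#(⊤ : SimpleGraph (Fin n)).edgeFinset : ℝ) ≤ (n : ℝ) ^ 2 := by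
  rw [SimpleGraph.card_edgeFinset_top_eq_card_choose_two, Fintype.card_fin]
  exact_mod_cast Nat.choose_le_pow n 2

lemma le_card_edgeFinset_top {n : ℕ} (hn : 2 ≤ n) :
    (n : ℝ) ^ 2 / 4 ≤ #(⊤ : SimpleGraph (Fin n)).edgeFinset := by
  rw [SimpleGraph.card_edgeFinset_top_eq_card_choose_two, Fintype.card_fin, Nat.cast_choose_two]
  have : (2 : ℝ) ≤ n := by exact_mod_cast hn
  nlinarith

lemma not_isDiag_of_mem_top {V : Type*} [Fintype V] [DecidableEq V] {e : Sym2 V}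
    (he : e ∈ (⊤ : SimpleGraph V).edgeFinset) : ¬ e.IsDiag := by
  simpa using he

/-- At `p = C p*_H(n)` with `C ≥ 1`, a given pair lies in no copy of `H` with probability
`O(n ^ (-D (2 - 1 / m₂(H))))` for every `D < C`. -/
lemma eventually_prob_avoid_le (hbal : IsStrictlyTwoBalanced H) (hconn : H.Connected) {C D : ℝ}
    (hC : 1 ≤ C) (hDC : D < C) :
    ∀ᶠ n : ℕ in atTop, C * pStar H n < 1 ∧ ∀ e : Sym2 (Fin n), ¬ e.IsDiag →
      prob (C * pStar H n) (avoid (rooted H {e}) unroot) ≤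
        2 * (n : ℝ) ^ (-(D * (2 - 1 / maxTwoDensity H))) := by
  set κ := 2 - 1 / maxTwoDensity H with hκ
  have hκ1 : 1 ≤ κ := one_le_exponent hbal hconn
  have he2 := two_le_card_edgeFinset hbal hconn
  have hC0 : 0 < C := by linarith
  have hratio : Tendsto (fun n : ℕ ↦ (((n : ℝ) - Fintype.card W) / n) ^ (Fintype.card W - 2))
      atTop (𝓝 1) := by
    have h1 : Tendsto (fun n : ℕ ↦ 1 - (Fintype.card W : ℝ) / n) atTop (𝓝 (1 - 0)) :=
      tendsto_const_nhds.sub (tendsto_const_div_atTop_nhds_zero_nat _)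
    have h2 := h1.pow (Fintype.card W - 2)
    rw [sub_zero, one_pow] at h2
    refine h2.congr' ?_
    filter_upwards [eventually_ge_atTop 1] with n hn
    have hn0 : (n : ℝ) ≠ 0 := by exact_mod_cast (by omega : n ≠ 0)
    rw [sub_div, div_self hn0]
  have hexp : Tendsto (fun n : ℕ ↦ Real.exp (errorTerm H n (C * pStar H n))) atTop (𝓝 1) := by
    have := (Real.continuous_exp.tendsto 0).comp (tendsto_errorTerm hbal hconn C)
    rwa [Real.exp_zero] at this
  filter_upwards [(tendsto_pStar hbal hconn C).eventually_lt_const one_pos,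
    hratio.eventually_const_lt ((div_lt_one hC0).2 hDC), hexp.eventually_le_const one_lt_two,
    eventually_ge_atTop (Fintype.card W), eventually_ge_atTop 1] with n hp hr herr hnW hn
  refine ⟨hp, fun e he ↦ ?_⟩
  have hn0 : (0 : ℝ) < n := by exact_mod_cast hn
  have hP := pStar_nonneg hbal hconn n
  have h0 : 0 ≤ C * pStar H n := mul_nonneg hC0.le hP
  have hjan := prob_avoid_rooted_singleton_le hbal hconn he h0 hp.le
  rw [Real.exp_add, Fintype.card_fin] at hjan
  have hlog := Real.log_natCast_nonneg n
  have hcount := le_card_copiesThrough hbal hconn he (by simpa using hnW)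
  rw [Fintype.card_fin] at hcount
  have hmu : D * κ * Real.log n ≤
      #(copiesThrough H e) * (C * pStar H n) ^ (#H.edgeFinset - 1) := by
    have hCpow : C ≤ C ^ (#H.edgeFinset - 1) := le_self_pow₀ hC (by omega)
    have hid := rho_mul_pow_mul_pStar_pow hbal hconn hn
    have hr' : D ≤ C * (((n : ℝ) - Fintype.card W) / n) ^ (Fintype.card W - 2) := by
      have := (div_lt_iff₀ hC0).1 hr
      linarith
    have hr0 : 0 ≤ (((n : ℝ) - Fintype.card W) / n) ^ (Fintype.card W - 2) := by
      have : (Fintype.card W : ℝ) ≤ n := by exact_mod_cast hnW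
      exact pow_nonneg (div_nonneg (by linarith) hn0.le) _
    calc D * κ * Real.log n = D * (κ * Real.log n) := by ring
      _ ≤ C * (((n : ℝ) - Fintype.card W) / n) ^ (Fintype.card W - 2) * (κ * Real.log n) :=
          mul_le_mul_of_nonneg_right hr' (by positivity)
      _ ≤ C ^ (#H.edgeFinset - 1) *
          (((n : ℝ) - Fintype.card W) / n) ^ (Fintype.card W - 2) * (κ * Real.log n) := by
          gcongr
      _ = rho H * ((n : ℝ) - Fintype.card W) ^ (Fintype.card W - 2) *
          (C * pStar H n) ^ (#H.edgeFinset - 1) := by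
          rw [← hid, div_pow, mul_pow C]
          field_simp
      _ ≤ _ := mul_le_mul_of_nonneg_right hcount (by positivity)
  refine hjan.trans ?_
  rw [mul_comm]
  refine mul_le_mul herr ?_ (Real.exp_pos _).le (by norm_num)
  rw [Real.rpow_def_of_pos hn0]
  refine Real.exp_le_exp.2 ?_
  linarith

theorem tendsto_binomialRandom_one (hbal : IsStrictlyTwoBalanced H) (hconn : H.Connected) {ε : ℝ}
    (hε : 0 < ε) {p : ℕ → unitInterval}
    (hp : ∀ᶠ n : ℕ in atTop, (1 + ε) * pStar H n < (p n : ℝ)) :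
    Tendsto (fun n : ℕ ↦ SimpleGraph.binomialRandom (Fin n) (p n)
      (edgesInCopies H (Fin n))) atTop (𝓝 1) := by
  simp only [binomialRandom_edgesInCopies]
  set κ := 2 - 1 / maxTwoDensity H with hκ
  have hκ1 : 1 ≤ κ := one_le_exponent hbal hconn
  set Q : ∀ n : ℕ, Set (Finset (Sym2 (Fin n))) := fun n ↦
    {S | ∀ e ∈ (⊤ : SimpleGraph (Fin n)).edgeFinset, S ∉ badEdge H e} with hQ
  -- Up to `C p*` the number of edges is bounded by `C n ^ 2 p*`. Beyond `C p*` the trivial bound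
  -- `n ^ 2` suffices, as a pair then lies in no copy with probability `O(n ^ (-3 κ))` and `1 ≤ κ`.
  set C : ℝ := 4 + ε with hC
  have hE1 : Tendsto (fun n : ℕ ↦ (n : ℝ) ^ 2 *
      (C * pStar H n * (2 * (n : ℝ) ^ (-((1 + ε / 2) * κ))))) atTop (𝓝 0) := by
    set c := κ * (rho H)⁻¹ with hc
    have hc0 : 0 ≤ c := (coeff_pos hbal hconn).le
    have h := (tendsto_rpow_mul_log_rpow (a := -(ε / 2 * κ)) (by
      rw [neg_lt_zero]; positivity) (1 / ((#H.edgeFinset - 1 : ℕ) : ℝ))).const_mul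
        (2 * C * c ^ (1 / ((#H.edgeFinset - 1 : ℕ) : ℝ)))
    rw [mul_zero] at h
    refine h.congr' ?_
    filter_upwards [eventually_ge_atTop 1] with n hn
    have hn0 : (0 : ℝ) < n := by exact_mod_cast hn
    have hl := Real.log_natCast_nonneg n
    have hpow : (n : ℝ) ^ (-(ε / 2 * κ)) =
        (n : ℝ) ^ 2 * (n : ℝ) ^ (-(1 / maxTwoDensity H)) * (n : ℝ) ^ (-((1 + ε / 2) * κ)) := by
      rw [← Real.rpow_natCast, ← Real.rpow_add hn0, ← Real.rpow_add hn0]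
      congr 1
      push_cast
      rw [hκ]
      ring
    rw [pStar_eq hbal hconn, Real.mul_rpow hc0 hl, hpow]
    ring
  have hE2 : Tendsto (fun n : ℕ ↦ (n : ℝ) ^ 2 * (2 * (n : ℝ) ^ (-(3 * κ)))) atTop (𝓝 0) := by
    have h := (tendsto_rpow_mul_log_rpow (a := 2 - 3 * κ) (by linarith) 0).const_mul 2
    rw [mul_zero] at h
    refine h.congr' ?_
    filter_upwards [eventually_ge_atTop 1] with n hn
    have hn0 : (0 : ℝ) < n := by exact_mod_cast hn
    rw [Real.rpow_zero, sub_eq_add_neg, Real.rpow_add hn0, ← Real.rpow_natCast]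
    push_cast
    ring
  have hlower : ∀ᶠ n : ℕ in atTop, 1 - ((n : ℝ) ^ 2 *
      (C * pStar H n * (2 * (n : ℝ) ^ (-((1 + ε / 2) * κ)))) +
        (n : ℝ) ^ 2 * (2 * (n : ℝ) ^ (-(3 * κ)))) ≤ prob (p n : ℝ) (Q n) := by
    filter_upwards [hp, eventually_prob_avoid_le hbal hconn (C := 1 + ε) (D := 1 + ε / 2)
      (by linarith) (by linarith), eventually_prob_avoid_le hbal hconn (C := C) (D := 3)
      (by linarith) (by linarith), eventually_ge_atTop 2] with n hpn h1 h2 hn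
    have hP := pStar_pos hbal hconn hn
    have h0 : (0 : ℝ) ≤ p n := (p n).2.1
    have h1' : (p n : ℝ) ≤ 1 := (p n).2.2
    have hpair : ∀ e ∈ (⊤ : SimpleGraph (Fin n)).edgeFinset, prob (p n : ℝ) (badEdge H e) ≤
        C * pStar H n * (2 * (n : ℝ) ^ (-((1 + ε / 2) * κ))) + 2 * (n : ℝ) ^ (-(3 * κ)) := by
      intro e he
      rw [prob_badEdge]
      have hed := not_isDiag_of_mem_top he
      have hnn := prob_nonneg h0 h1' (avoid (rooted H {e}) unroot)
      have hA : 0 ≤ 2 * (n : ℝ) ^ (-((1 + ε / 2) * κ)) := by positivity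
      have hB : 0 ≤ 2 * (n : ℝ) ^ (-(3 * κ)) := by positivity
      rcases le_or_gt (p n : ℝ) (C * pStar H n) with hle | hgt
      · have h3 := (prob_anti (mul_pos (by linarith) hP) hpn.le h1.1 h1'
          (isLowerSet_avoid (rooted H {e}) unroot)).trans (h1.2 e hed)
        have h4 := mul_le_mul hle h3 hnn (by positivity)
        linarith
      · have h3 := (prob_anti (mul_pos (by linarith) hP) hgt.le h2.1 h1'
          (isLowerSet_avoid (rooted H {e}) unroot)).trans (h2.2 e hed)
        have h4 := mul_le_mul h1' h3 hnn zero_le_one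
        have h5 : 0 ≤ C * pStar H n * (2 * (n : ℝ) ^ (-((1 + ε / 2) * κ))) := by positivity
        linarith
    have hcompl : (Q n)ᶜ ⊆ ⋃ e ∈ (⊤ : SimpleGraph (Fin n)).edgeFinset, badEdge H e := by
      intro S hS
      simpa [hQ] using hS
    have hsum : prob (p n : ℝ) (Q n)ᶜ ≤ (n : ℝ) ^ 2 *
        (C * pStar H n * (2 * (n : ℝ) ^ (-((1 + ε / 2) * κ))) + 2 * (n : ℝ) ^ (-(3 * κ))) := by
      refine (prob_mono h0 h1' hcompl).trans ((prob_biUnion_le h0 h1' _ _).trans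
        ((sum_le_card_nsmul _ _ _ hpair).trans ?_))
      rw [nsmul_eq_mul]
      exact mul_le_mul_of_nonneg_right (card_edgeFinset_top_le n) (by positivity)
    have := prob_add_prob_compl (p := (p n : ℝ)) (Q n)
    linarith
  have hupper : ∀ n : ℕ, prob (p n : ℝ) (Q n) ≤ 1 := by
    intro n
    have := prob_add_prob_compl (p := (p n : ℝ)) (Q n)
    have := prob_nonneg (p n).2.1 (p n).2.2 (Q n)ᶜ
    linarith
  have hlim : Tendsto (fun n : ℕ ↦ prob (p n : ℝ) (Q n)) atTop (𝓝 1) := by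
    refine tendsto_of_tendsto_of_tendsto_of_le_of_le' ?_ tendsto_const_nhds hlower
      (Eventually.of_forall hupper)
    have := (hE1.add hE2).const_sub 1
    simpa using this
  have := ENNReal.tendsto_ofReal hlim
  rwa [ENNReal.ofReal_one] at this

/-- Below the threshold, the expected number of edges lying in no copy of `H` tends to infinity. -/
lemma tendsto_sum_prob_badEdge (hbal : IsStrictlyTwoBalanced H) (hconn : H.Connected) {ε : ℝ}
    (hε : 0 < ε) (hε1 : ε < 1) {p : ℕ → unitInterval}
    (hp2 : (fun n : ℕ ↦ ((n : ℝ) ^ 2)⁻¹) =o[atTop] (fun n : ℕ ↦ (p n : ℝ)))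
    (hp : ∀ᶠ n : ℕ in atTop, (p n : ℝ) < (1 - ε) * pStar H n) :
    Tendsto (fun n : ℕ ↦ ∑ e ∈ (⊤ : SimpleGraph (Fin n)).edgeFinset,
      prob (p n : ℝ) (badEdge H e)) atTop atTop := by
  set κ := 2 - 1 / maxTwoDensity H with hκ
  have hκ1 : 1 ≤ κ := one_le_exponent hbal hconn
  have he2 := two_le_card_edgeFinset hbal hconn
  have hrho := rho_pos hbal hconn
  have hmain : Tendsto (fun n : ℕ ↦ (n : ℝ) ^ 2 * p n *
      Real.exp (-(rho H * ((n : ℝ) ^ (Fintype.card W - 2) * (p n : ℝ) ^ (#H.edgeFinset - 1)))))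
      atTop atTop := by
    refine tendsto_atTop.2 fun K ↦ ?_
    have hpow : ∀ᶠ n : ℕ in atTop, K ≤ (n : ℝ) ^ (ε * κ) :=
      ((tendsto_rpow_atTop (by positivity)).comp
        tendsto_natCast_atTop_atTop).eventually_ge_atTop K
    set L : ℝ := max K 1 * Real.exp (rho H) with hL
    have hL0 : 0 < L := by positivity
    filter_upwards [hpow, hp, hp2.def (inv_pos.2 hL0), eventually_ge_atTop 1] with n hKn hpn hpn2 hn
    have hn0 : (0 : ℝ) < n := by exact_mod_cast hn
    have h0 : (0 : ℝ) ≤ p n := (p n).2.1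
    have hP := pStar_nonneg hbal hconn n
    have hl := Real.log_natCast_nonneg n
    -- If `n ^ (-1 / m₂) ≤ p`, the number of edges makes up for the exponential by `p < (1 - ε) p*`.
    -- Otherwise, the exponential is at least `exp (-ρ)`, and `n ^ 2 p → ∞` suffices.
    rcases le_or_gt ((n : ℝ) ^ (-(1 / maxTwoDensity H))) (p n) with hle | hlt
    · have h1 : rho H * ((n : ℝ) ^ (Fintype.card W - 2) * (p n : ℝ) ^ (#H.edgeFinset - 1)) ≤
          (1 - ε) * (κ * Real.log n) := by
        rw [← rho_mul_pow_mul_pStar_pow hbal hconn hn]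
        have h2 : (p n : ℝ) ^ (#H.edgeFinset - 1) ≤
            (1 - ε) * pStar H n ^ (#H.edgeFinset - 1) := by
          refine (pow_le_pow_left₀ h0 hpn.le _).trans ?_
          rw [mul_pow]
          refine mul_le_mul_of_nonneg_right ?_ (by positivity)
          exact pow_le_of_le_one (by linarith) (by linarith) (by omega)
        calc _ ≤ rho H * ((n : ℝ) ^ (Fintype.card W - 2) *
              ((1 - ε) * pStar H n ^ (#H.edgeFinset - 1))) := by gcongr
          _ = _ := by ring
      calc K ≤ (n : ℝ) ^ (ε * κ) := hKn
        _ = (n : ℝ) ^ 2 * (n : ℝ) ^ (-(1 / maxTwoDensity H)) *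
            Real.exp (-((1 - ε) * (κ * Real.log n))) := by
          have : Real.exp (-((1 - ε) * (κ * Real.log n))) = (n : ℝ) ^ (-((1 - ε) * κ)) := by
            rw [Real.rpow_def_of_pos hn0]
            congr 1
            ring
          rw [this, ← Real.rpow_natCast, ← Real.rpow_add hn0, ← Real.rpow_add hn0]
          congr 1
          push_cast
          rw [hκ]
          ring
        _ ≤ _ := by gcongr
    · have h1 : rho H * ((n : ℝ) ^ (Fintype.card W - 2) * (p n : ℝ) ^ (#H.edgeFinset - 1)) ≤
          rho H := by
        have h2 : (n : ℝ) ^ (Fintype.card W - 2) *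
            ((n : ℝ) ^ (-(1 / maxTwoDensity H))) ^ (#H.edgeFinset - 1) = 1 := by
          have hE : ((#H.edgeFinset - 1 : ℕ) : ℝ) ≠ 0 := by
            exact_mod_cast (by omega : #H.edgeFinset - 1 ≠ 0)
          rw [← Real.rpow_natCast (_ ^ (-_)), ← Real.rpow_mul hn0.le, ← Real.rpow_natCast (n : ℝ),
            ← Real.rpow_add hn0, one_div_maxTwoDensity hbal hconn, neg_mul, div_mul_cancel₀ _ hE,
            add_neg_cancel, Real.rpow_zero]
        have h3 : (n : ℝ) ^ (Fintype.card W - 2) * (p n : ℝ) ^ (#H.edgeFinset - 1) ≤ 1 := by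
          rw [← h2]
          gcongr
        nlinarith
      have h4 : L ≤ (n : ℝ) ^ 2 * p n := by
        rw [Real.norm_of_nonneg (by positivity), Real.norm_of_nonneg h0,
          inv_le_iff_one_le_mul₀ (by positivity)] at hpn2
        field_simp at hpn2
        linarith
      calc K ≤ max K 1 := le_max_left _ _
        _ = L * Real.exp (-rho H) := by
            rw [hL, mul_assoc, ← Real.exp_add, add_neg_cancel, Real.exp_zero, mul_one]
        _ ≤ _ := by gcongr
  have hexp : Tendsto (fun n : ℕ ↦ Real.exp (-errorTerm H n (1 * pStar H n))) atTop (𝓝 1) := by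
    have := (Real.continuous_exp.tendsto (-0)).comp (tendsto_errorTerm hbal hconn 1).neg
    rwa [neg_zero, Real.exp_zero] at this
  have hsmall : Tendsto (fun n : ℕ ↦ (1 * pStar H n) ^ (#H.edgeFinset - 1)) atTop (𝓝 0) := by
    have := (tendsto_pStar hbal hconn 1).pow (#H.edgeFinset - 1)
    rwa [zero_pow (by omega)] at this
  refine tendsto_atTop_mono' _ ?_ (hmain.const_mul_atTop (show (0 : ℝ) < 1 / 8 by norm_num))
  filter_upwards [hp, hexp.eventually_const_le (show (1 / 2 : ℝ) < 1 by norm_num),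
    hsmall.eventually_le_const (show (0 : ℝ) < 1 / 2 by norm_num), eventually_ge_atTop 2]
    with n hpn herr hsm hn
  rw [one_mul] at herr hsm
  have h0 : (0 : ℝ) ≤ p n := (p n).2.1
  have hP := pStar_nonneg hbal hconn n
  have hle : (p n : ℝ) ≤ pStar H n := by nlinarith
  have hsm' : (p n : ℝ) ^ (#H.edgeFinset - 1) ≤ 1 / 2 := (pow_le_pow_left₀ h0 hle _).trans hsm
  set x := (n : ℝ) ^ (Fintype.card W - 2) * (p n : ℝ) ^ (#H.edgeFinset - 1) with hx
  have hpair : ∀ e ∈ (⊤ : SimpleGraph (Fin n)).edgeFinset,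
      p n * (Real.exp (-(rho H * x)) * (1 / 2)) ≤ prob (p n : ℝ) (badEdge H e) := by
    intro e he
    have hed := not_isDiag_of_mem_top he
    refine le_trans ?_ (le_prob_badEdge e h0 (p n).2.2 hsm')
    refine mul_le_mul_of_nonneg_left ?_ h0
    refine (mul_le_mul_of_nonneg_left herr (Real.exp_pos _).le).trans ?_
    rw [← Real.exp_add]
    refine Real.exp_le_exp.2 ?_
    have hmono := errorTerm_mono (H := H) (n := n) h0 hle
    have hcount := card_copiesThrough_le hbal hconn hed
    rw [Fintype.card_fin] at hcount
    have hpart : 4 * rho H * ((n : ℝ) ^ (Fintype.card W - 2) *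
        (p n : ℝ) ^ (2 * (#H.edgeFinset - 1))) ≤ errorTerm H n (p n) := by
      have h2 := extensionSum_nonneg (H := H) (n := n) h0
      rw [errorTerm]
      refine le_add_of_nonneg_left ?_
      positivity
    rw [mul_comm 2 (#H.edgeFinset - 1), pow_mul] at hpart
    set q := (p n : ℝ) ^ (#H.edgeFinset - 1)
    have hq0 : 0 ≤ q := by positivity
    have h3 := mul_le_mul_of_nonneg_right hcount (show 0 ≤ q + 2 * q ^ 2 by positivity)
    have h4 : 0 ≤ rho H * ((n : ℝ) ^ (Fintype.card W - 2) * q ^ 2) := by positivity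
    rw [hx]
    linarith
  have hsum := card_nsmul_le_sum _ _ _ hpair
  rw [nsmul_eq_mul] at hsum
  refine le_trans ?_ hsum
  have hcard := le_card_edgeFinset_top hn
  calc 1 / 8 * ((n : ℝ) ^ 2 * p n * Real.exp (-(rho H * x)))
      = (n : ℝ) ^ 2 / 4 * (p n * (Real.exp (-(rho H * x)) * (1 / 2))) := by ring
    _ ≤ _ := mul_le_mul_of_nonneg_right hcard (by positivity)

theorem tendsto_binomialRandom_zero (hbal : IsStrictlyTwoBalanced H) (hconn : H.Connected) {ε : ℝ}
    (hε : 0 < ε) {p : ℕ → unitInterval}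
    (hp2 : (fun n : ℕ ↦ ((n : ℝ) ^ 2)⁻¹) =o[atTop] (fun n : ℕ ↦ (p n : ℝ)))
    (hp : ∀ᶠ n : ℕ in atTop, (p n : ℝ) < (1 - ε) * pStar H n) :
    Tendsto (fun n : ℕ ↦ SimpleGraph.binomialRandom (Fin n) (p n)
      (edgesInCopies H (Fin n))) atTop (𝓝 0) := by
  have he2 := two_le_card_edgeFinset hbal hconn
  -- For `ε ≥ 1` no `p` satisfies the upper bound.
  have hε1 : ε < 1 := by
    obtain ⟨n, hn⟩ := hp.exists
    by_contra! h
    have h1 := mul_nonneg (sub_nonneg.2 h) (pStar_nonneg hbal hconn n)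
    have h2 : (0 : ℝ) ≤ p n := (p n).2.1
    linarith
  have hM := tendsto_sum_prob_badEdge hbal hconn hε hε1 hp2 hp
  have hexp : Tendsto (fun n : ℕ ↦ Real.exp (errorTerm H n (1 * pStar H n))) atTop (𝓝 1) := by
    have := (Real.continuous_exp.tendsto 0).comp (tendsto_errorTerm hbal hconn 1)
    rwa [Real.exp_zero] at this
  have hsmall : Tendsto (fun n : ℕ ↦ (1 * pStar H n) ^ (#H.edgeFinset - 1)) atTop (𝓝 0) := by
    have := (tendsto_pStar hbal hconn 1).pow (#H.edgeFinset - 1)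
    rwa [zero_pow (by omega)] at this
  simp only [binomialRandom_edgesInCopies]
  rw [← ENNReal.ofReal_zero]
  refine ENNReal.tendsto_ofReal ?_
  have hlim := hM.inv_tendsto_atTop.add (hexp.sub_const 1)
  rw [sub_self, add_zero] at hlim
  refine tendsto_of_tendsto_of_tendsto_of_le_of_le' tendsto_const_nhds hlim
    (Eventually.of_forall fun n ↦ prob_nonneg (p n).2.1 (p n).2.2 _) ?_
  filter_upwards [hp, hsmall.eventually_le_const (show (0 : ℝ) < 1 / 2 by norm_num),
    hM.eventually_gt_atTop 0] with n hpn hsm hpos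
  rw [one_mul] at hsm ⊢
  have h0 : (0 : ℝ) ≤ p n := (p n).2.1
  have hP := pStar_nonneg hbal hconn n
  have hle : (p n : ℝ) ≤ pStar H n := by nlinarith
  have hsm' : (p n : ℝ) ^ (#H.edgeFinset - 1) ≤ 1 / 2 := (pow_le_pow_left₀ h0 hle _).trans hsm
  have herr0 : 0 ≤ errorTerm H n (p n) := by
    have h2 := extensionSum_nonneg (H := H) (n := n) h0
    have := (rho_pos hbal hconn).le
    unfold errorTerm
    positivity
  have hmono := errorTerm_mono (H := H) (n := n) h0 hle
  refine prob_forall_notMem_le h0 (p n).2.2 _ _ ?_ ?_ hpos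
  · rw [sub_nonneg]
    exact Real.one_le_exp (herr0.trans hmono)
  · intro e he f hf hef
    refine (prob_badEdge_inter_le hbal hconn hef (not_isDiag_of_mem_top he)
      (not_isDiag_of_mem_top hf) h0 (p n).2.2 hsm').trans ?_
    rw [Fintype.card_fin, add_sub_cancel]
    exact mul_le_mul_of_nonneg_right (Real.exp_le_exp.2 hmono)
      (mul_nonneg (prob_nonneg h0 (p n).2.2 _) (prob_nonneg h0 (p n).2.2 _))

end Threshold

end SharpThreshold

theorem mainTheorem3 {W : Type*} [Finite W] (H : SimpleGraph W)
    (hbal : SharpThreshold.IsStrictlyTwoBalanced H) (hconn : H.Connected)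
    (ε : ℝ) (hε : 0 < ε) :
    (∀ p : ℕ → unitInterval,
      (fun n : ℕ => ((n : ℝ) ^ 2)⁻¹) =o[atTop] (fun n : ℕ => (p n : ℝ)) →
      (∀ᶠ n : ℕ in atTop, (p n : ℝ) < (1 - ε) * SharpThreshold.pStar H n) →
      Tendsto (fun n : ℕ => SimpleGraph.binomialRandom (Fin n) (p n)
        (SharpThreshold.edgesInCopies H (Fin n))) atTop (𝓝 0)) ∧
    (∀ p : ℕ → unitInterval,
      (∀ᶠ n : ℕ in atTop, (1 + ε) * SharpThreshold.pStar H n < (p n : ℝ)) →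
      Tendsto (fun n : ℕ => SimpleGraph.binomialRandom (Fin n) (p n)
        (SharpThreshold.edgesInCopies H (Fin n))) atTop (𝓝 1)) := by
  classical
  have : Fintype W := Fintype.ofFinite W
  exact ⟨fun _ hp2 hp ↦ SharpThreshold.tendsto_binomialRandom_zero hbal hconn hε hp2 hp,
    fun _ hp ↦ SharpThreshold.tendsto_binomialRandom_one hbal hconn hε hp⟩
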